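/- **Setting.** Let $\mathbb K$ be a field of characteristic $0$ or $\mathbb K=\mathbb Z$, let $\mathbb P=\mathrm{Trop}(Z_1,\dots,Z_m)$ be the tropical semifield (the free abelian group on $Z_1,\dots,Z_m$ with $\prod_i Z_i^{a_i}\oplus\prod_i Z_i^{b_i}=\prod_i Z_i^{\min(a_i,b_i)}$), let $\mathbb{KP}$ be its group ring, and let $\mathcal F$ be the field of rational functions in $n$ variables over $\mathbb{KP}$. Let $(B,X,A)$ be a labeled seed at $t_0$: $B$ is a skew-symmetrizable $n\times n$ integer matrix, $X=(X_1,\dots,X_n)\in\mathbb P^n$, and $A=(A_{1;t_0},\dots,A_{n;t_0})$ is a free generating set of the field $\mathcal F$ over $\mathbb{KP}$. Its mutation at $k$ is $(B',X',A')$ with * $b'_{ij}=-b_{ij}$ if $i=k$ or $j=k$, and $b'_{ij}=b_{ij}+\mathrm{sgn}(b_{ik})\max(b_{ik}b_{kj},0)$ otherwise; * $X_k'=X_k^{-1}$, and $X_i'=X_iX_k^{\max(b_{ki},0)}(1\oplus X_k)^{-b_{ki}}$ for $i\ne k$; * $A_i'=A_i$ for $i\neq k$, and $A_k'=A_k^{-1}\Big(\frac{X_k}{1\oplus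 X_k}\prod_{b_{jk}>0}A_j^{b_{jk}}+\frac{1}{1\oplus X_k}\prod_{b_{jk}<0}A_j^{-b_{jk}}\Big)$. Let $\mathcal U=\bigcap_t\mathbb{KP}[A_{1;t}^{\pm1},\dots,A_{n;t}^{\pm1}]\subset\mathcal F$ be the upper cluster algebra, where $t$ runs over all seeds obtained from $t_0$ by finite sequences of mutations. Suppose that $\mathcal U$ is of full rank: writing $X_k=\prod_i Z_i^{c_{ik}}$ and $C=(c_{ik})$, the $(n+m)\times n$ matrix $\begin{pmatrix}B\\C\end{pmatrix}$ has rank $n$. For $M\in\mathcal U$ and a cluster variable $a$ put $(a\|M)_v=\max\{s\in\mathbb N: M/a^s\in\mathcal U\}\in\mathbb N\cup\{\infty\}$. A nonzero $M\in\mathcal U$ can be written uniquely as $$M=\frac{P_M(A_{1;t_0},\dots,A_{n;t_0})}{A_{1;t_0}^{d_1}\cdots A_{n;t_0}^{d_n}},\qquad d_i\in\mathbb Z,$$ where $P_M$ is a polynomial over $\mathbb{KP}$ divisible by none of its $n$ variables. The polynomial $P_M$ is the numerator polynomial and $\mathbf d_M=(d_1,\dots,d_n)^{\mathrm T}$ the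 $d$-vector of $M$ with respect to $t_0$. Write $(A_{k;t_0}\|M)_d$ for the $k$-th component of the $d$-vector of $M$ with respect to $t_0$. The element $P_M(A_{1;t_0},\dots,A_{n;t_0})$, again denoted $P_M$, lies in $\mathcal U$. **Theorem 5.1.** Let $0\ne M\in\mathcal U$ with $d$-vector $\mathbf d_M=(d_1,\dots,d_n)^{\mathrm T}$ and numerator polynomial $P_M$ with respect to $t_0$. 1. For every $k=1,\dots,n$, the integers $(A_{k;t_0}\|P_M)_v$ and $(A_{k;t_0}\|M)_v$ are finite and $$d_k=(A_{k;t_0}\|M)_d=(A_{k;t_0}\|P_M)_v-(A_{k;t_0}\|M)_v.$$ 2. For every $k$, $(A_{k;t_0}\|M)_v=0$ if and only if $M/A_{k;t_0}\notin\mathcal U$, and in this case $d_k=(A_{k;t_0}\|M)_d=(A_{k;t_0}\|P_M)_v\ge0$. 3. If $(A_{k;t_0}\|M)_v=0$ for all $k=1,\dots,n$, then $\mathbf d_M$ is uniquely determined by $P_M$: if $M'\in\mathcal U$ is another nonzero element with $(A_{k;t_0}\|M')_v=0$ for all $k$ and $P_{M'}=P_M$, then $\mathbf d_{M'}=\mathbf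 d_M$. -/

import Mathlib

noncomputable section

namespace ClusterAlg

/-- A semifield in the sense of cluster algebra theory: an abelian multiplicative group with a
commutative and associative auxiliary addition over which the multiplication distributes. -/
class AuxSemifield (P : Type*) extends CommGroup P where
  oplus : P → P → P
  oplus_comm : ∀ a b, oplus a b = oplus b a
  oplus_assoc : ∀ a b c, oplus (oplus a b) c = oplus a (oplus b c)
  mul_oplus : ∀ a b c, a * oplus b c = oplus (a * b) (a * c)

/-- The tropical semifield `Trop(Z₁, …, Z_m)`: the free abelian group on `Z₁, …, Z_m`, where the
monomial `Z₁^(a 1) ⋯ Z_m^(a m)` is represented by its exponent vector `a`, written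
multiplicatively. -/
abbrev Trop (m : ℕ) : Type := Multiplicative (Fin m → ℤ)

/-- The auxiliary addition of `Trop m` is the componentwise minimum of the exponents. -/
instance (m : ℕ) : AuxSemifield (Trop m) where
  oplus a b := Multiplicative.ofAdd fun i =>
    min (Multiplicative.toAdd a i) (Multiplicative.toAdd b i)
  oplus_comm _ _ := congrArg Multiplicative.ofAdd (funext fun _ => min_comm _ _)
  oplus_assoc _ _ _ := congrArg Multiplicative.ofAdd (funext fun _ => min_assoc _ _ _)
  mul_oplus _ _ _ := congrArg Multiplicative.ofAdd (funext fun _ => (min_add_add_left _ _ _).symm)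

/-- There is an integer diagonal matrix `S` with strictly positive diagonal entries `s i` such that
`S * B` is skew-symmetric. -/
def IsSkewSymmetrizable {n : ℕ} (B : Matrix (Fin n) (Fin n) ℤ) : Prop :=
  ∃ s : Fin n → ℤ, (∀ i, 0 < s i) ∧ ∀ i j, s i * B i j = -(s j * B j i)

/-- Mutation of an exchange matrix in direction `k`. -/
def mutateMatrix {n : ℕ} (B : Matrix (Fin n) (Fin n) ℤ) (k : Fin n) :
    Matrix (Fin n) (Fin n) ℤ :=
  Matrix.of fun i j =>
    if i = k ∨ j = k then -B i j else B i j + (B i k).sign * max (B i k * B k j) 0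

/-- The data `(B, X, A)` of a labeled seed of rank `n` over the semifield `P` with ambient field
`F`. That such data form a seed is the predicate `SeedData.IsSeed`. -/
structure SeedData (P F : Type*) (n : ℕ) where
  /-- the exchange matrix -/
  B : Matrix (Fin n) (Fin n) ℤ
  /-- the coefficient tuple -/
  X : Fin n → P
  /-- the cluster -/
  A : Fin n → F

namespace SeedData

section General

variable (K : Type*) [CommRing K] {P : Type*} [AuxSemifield P] {F : Type*} [Field F]
  [Algebra (MonoidAlgebra K P) F] {n : ℕ}

/-- `(B, X, A)` is a seed in `F` over the group ring `KP`: `B` is skew-symmetrizable, and the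
cluster is a free generating set of the field `F` over `KP`, that is, its members are algebraically
independent over `KP` and every element of `F` is a quotient of two polynomials in them. (So `F` is
a field of rational functions in `n` independent variables with coefficients in `KP`.) -/
structure IsSeed (S : SeedData P F n) : Prop where
  skew : IsSkewSymmetrizable S.B
  algebraicIndependent : AlgebraicIndependent (MonoidAlgebra K P) S.A
  generates : ∀ f : F, ∃ p q : MvPolynomial (Fin n) (MonoidAlgebra K P),
    q ≠ 0 ∧ f = MvPolynomial.aeval S.A p / MvPolynomial.aeval S.A q

/-- An element of the coefficient group `P`, seen in the ambient field `F`. -/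
def coeff (F : Type*) [Field F] [Algebra (MonoidAlgebra K P) F] (p : P) : F :=
  algebraMap (MonoidAlgebra K P) F (MonoidAlgebra.of K P p)

/-- The `k`-th exchange binomial
`X_k / (1 ⊕ X_k) * ∏_{b_jk > 0} A_j ^ b_jk + 1 / (1 ⊕ X_k) * ∏_{b_jk < 0} A_j ^ (-b_jk)`. -/
def exchangeBinomial (S : SeedData P F n) (k : Fin n) : F :=
  coeff K F (S.X k / AuxSemifield.oplus 1 (S.X k)) * ∏ j, S.A j ^ (S.B j k).toNat
    + coeff K F (1 / AuxSemifield.oplus 1 (S.X k)) * ∏ j, S.A j ^ (-S.B j k).toNat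

/-- Mutation of the seed `(B, X, A)` in direction `k`. -/
def mutate (S : SeedData P F n) (k : Fin n) : SeedData P F n where
  B := mutateMatrix S.B k
  X i := if i = k then (S.X k)⁻¹
    else S.X i * S.X k ^ max (S.B k i) 0 * AuxSemifield.oplus 1 (S.X k) ^ (-S.B k i)
  A i := if i = k then (S.A k)⁻¹ * S.exchangeBinomial K k else S.A i

/-- The seed at the end of the walk with edge labels `w` that starts at the initial vertex `t₀` of
the `n`-regular tree, where the seed `S` is placed at `t₀`. Every vertex of the tree is the end of
such a walk, and as mutations in a fixed direction are involutions on seeds, the seed depends only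
on the end of the walk. -/
def seedAt (S : SeedData P F n) (w : List (Fin n)) : SeedData P F n :=
  w.foldl (fun T k => T.mutate K k) S

/-- The Laurent polynomial ring `KP[A₁^{±1}, …, A_n^{±1}]` of a seed, inside `F`. -/
def laurentRing (S : SeedData P F n) : Subalgebra (MonoidAlgebra K P) F :=
  Algebra.adjoin (MonoidAlgebra K P) (Set.range S.A ∪ Set.range fun i => (S.A i)⁻¹)

/-- The upper cluster algebra of the seed pattern with initial seed `S`: the intersection of the
Laurent polynomial rings of all seeds of the pattern. -/
def upperClusterAlgebra (S : SeedData P F n) : Subalgebra (MonoidAlgebra K P) F :=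
  ⨅ w : List (Fin n), (S.seedAt K w).laurentRing K

/-- `M = p(A₁, …, A_n) / (A₁ ^ d₁ ⋯ A_n ^ d_n)` with a polynomial `p` over `KP` that is divisible by
none of the variables. Then `d` is the `d`-vector and `p` the numerator polynomial of `M` with
respect to the seed `S`. -/
structure IsReducedForm (S : SeedData P F n) (M : F) (d : Fin n → ℤ)
    (p : MvPolynomial (Fin n) (MonoidAlgebra K P)) : Prop where
  eq : M = MvPolynomial.aeval S.A p / ∏ i, S.A i ^ d i
  not_dvd : ∀ j, ¬ MvPolynomial.X j ∣ p

open Classical in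
/-- The `d`-vector of `M` with respect to the seed `S` (with value `0` if there is none). -/
def dVector (S : SeedData P F n) (M : F) : Fin n → ℤ :=
  if h : ∃ d : Fin n → ℤ, ∃ p, S.IsReducedForm K M d p then h.choose else 0

/-- The `d`-compatibility degree `(A_{k;t} || M)_d` of the `k`-th cluster variable of the seed `S`
at `t` with `M`: the `k`-th component of the `d`-vector of `M` with respect to this seed. -/
def dCompat (S : SeedData P F n) (k : Fin n) (M : F) : ℤ :=
  S.dVector K M k

end General

/-- The extended exchange matrix `(B, C)ᵀ` of a seed of geometric type: the `k`-th column of the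
coefficient matrix `C` is the exponent vector of `X_k`. -/
def extendedMatrix {m n : ℕ} {F : Type*} (S : SeedData (Trop m) F n) :
    Matrix (Fin n ⊕ Fin m) (Fin n) ℤ :=
  Matrix.fromRows S.B (Matrix.of fun i k => Multiplicative.toAdd (S.X k) i)

/-- The `(n + m) × n` extended exchange matrix has full rank, that is, rank `n`. -/
def IsFullRank {m n : ℕ} {F : Type*} (S : SeedData (Trop m) F n) : Prop :=
  (S.extendedMatrix.map (Int.cast : ℤ → ℚ)).rank = n

end SeedData

/-- The valuation pairing `(a || M)_v`: the largest `s` in `ℕ` such that `M / a ^ s` lies in the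
algebra `U`, or `⊤` if there are arbitrarily large such `s`. -/
def valPairing {R F : Type*} [CommRing R] [Field F] [Algebra R F] (U : Subalgebra R F)
    (a M : F) : ℕ∞ :=
  ⨆ s : {s : ℕ // M / a ^ s ∈ U}, ((s : ℕ) : ℕ∞)

end ClusterAlg

end

/-! Write `L_k` for the Laurent ring of the neighbour of the initial seed in direction `k`. In `L_k`
every `A_i` with `i ≠ k` is a unit, while `A_k` is, up to a unit, an exchange binomial with nonzero
exponent vector. Comparing supports shows that a nonzero element of `L_k` cannot be divisible by all
powers of such a binomial, so the order of a nonzero element of `U` along `A_k` in `L_k` is finite.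
Since `P_M` is `M` times the Laurent monomial `A^d`, whose factors other than `A_k ^ d_k` are units
of `L_k`, its order exceeds that of `M` by `d_k` (`exists_valPairing_eq`).

It remains to identify the order in `L_k` with the valuation pairing in `U`. This follows once `U`
is the intersection of the Laurent rings of the initial seed and its neighbours alone: `A_k` is a
unit in all of these except `L_k`, so only `L_k` restricts division by `A_k` (`div_pow_mem_iff`).

The reduction to neighbours (`mem_laurentRing_seedAt`) goes by induction along a walk and rests on
`mem_laurentSubalgebra_of_path`. For a path `t_q — t — t_p — t_{pq}`, let `R` be the Laurent ring at
`t_{pq}`. An element of the Laurent ring at `t_p` enters `R` after multiplication by a power of the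
last exchange binomial `Q`; one of the Laurent ring at `t_q` does so after multiplication by a power
of `f = z_p z_q'`, where `z_q'` is the new variable at `t_q`. If `f` is a nonzerodivisor modulo `Q`,
an element of both rings lies in `R`. Regularity comes either from congruence to a unit modulo `Q`,
or from a grading in which `Q` has degree `0` and the top component is a monomial. Full rank is used
twice: nonzero columns give finite orders, and nonproportional columns give regularity when the two
directions do not interact. -/

noncomputable section

namespace ClusterAlg

/-! ### Gradings, leading terms and divisibility in group rings. -/

section GroupRing

open AddMonoidAlgebra

variable {K G : Type*} [CommRing K] [AddCommGroup G]

/-- If `f = e^a + r` with `r` of smaller `l`-degree than `a`, then `f` is a nonzerodivisor modulo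
every element `Q` that is homogeneous of `l`-degree `0`. -/
lemma dvd_of_dvd_top_mul (l : G →+ ℤ) (a : G) (r Q : AddMonoidAlgebra K G)
    (hr : ∀ x ∈ r.coeff.support, l x < l a) (hQ : ∀ x ∈ Q.coeff.support, l x = 0)
    (g h : AddMonoidAlgebra K G) (e : (single a 1 + r) * g = Q * h) : Q ∣ g := by
  classical
  induction hc : g.coeff.support.card using Nat.strong_induction_on generalizing g h with
  | _ c ih =>
  by_cases hg : g = 0
  · simp [hg]
  have hne : g.coeff.support.Nonempty := by
    rw [Finsupp.support_nonempty_iff]; simpa using hg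
  obtain ⟨x₀, hx₀, hmax⟩ := Finset.exists_max_image g.coeff.support l hne
  set D := l x₀
  let comp (d : ℤ) (y : AddMonoidAlgebra K G) : AddMonoidAlgebra K G :=
    .ofCoeff (y.coeff.filter fun x => l x = d)
  let rest (d : ℤ) (y : AddMonoidAlgebra K G) : AddMonoidAlgebra K G :=
    .ofCoeff (y.coeff.filter fun x => ¬ l x = d)
  have hsplit (d y) : comp d y + rest d y = y := by
    apply AddMonoidAlgebra.ext
    exact Finsupp.filter_add_filter_not _ _
  have hcomp (d y) : ∀ x ∈ (comp d y).coeff.support, l x = d ∧ x ∈ y.coeff.support := by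
    intro x hx
    simp only [comp, Finsupp.support_filter, Finset.mem_filter] at hx
    exact ⟨hx.2, hx.1⟩
  have hrest (d y) : ∀ x ∈ (rest d y).coeff.support, l x ≠ d ∧ x ∈ y.coeff.support := by
    intro x hx
    simp only [rest, Finsupp.support_filter, Finset.mem_filter] at hx
    exact ⟨hx.2, hx.1⟩
  have hmul (y y' : AddMonoidAlgebra K G) (x : G) (hx : x ∈ (y * y').coeff.support) :
      ∃ s ∈ y.coeff.support, ∃ t ∈ y'.coeff.support, l x = l s + l t := by
    have := AddMonoidAlgebra.support_coeff_mul_subset y y' hx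
    obtain ⟨s, hs, t, ht, rfl⟩ := Finset.mem_add.1 this
    exact ⟨s, hs, t, ht, map_add l s t⟩
  have hsingle (x) (hx : x ∈ (single a (1 : K)).coeff.support) : x = a := by
    rw [coeff_single] at hx
    simpa using Finsupp.support_single_subset hx
  have hzero (y : AddMonoidAlgebra K G) (x : G) (hx : x ∉ y.coeff.support) : y.coeff x = 0 :=
    Finsupp.notMem_support_iff.1 hx
  -- Compare the parts of degree `l a + D`: on the left only `e^a` times the top component of `g`
  -- reaches this degree, and `Q` preserves degrees on the right.
  have key : single a 1 * comp D g = Q * comp (l a + D) h := by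
    have e' : single a 1 * comp D g + (single a 1 * rest D g + r * g)
        = Q * comp (l a + D) h + Q * rest (l a + D) h := by
      rw [← mul_add, hsplit, ← e, ← add_assoc, ← mul_add, hsplit, add_mul]
    apply AddMonoidAlgebra.ext
    ext x
    have ex := congrArg (fun y => y.coeff x) e'
    simp only [coeff_add, Finsupp.add_apply] at ex
    by_cases hx : l x = l a + D
    · have h1 : (single a 1 * rest D g).coeff x = 0 := by
        apply hzero
        intro hx'
        obtain ⟨s, hs, t, ht, hl⟩ := hmul _ _ _ hx'
        rw [hsingle s hs] at hl
        have := (hrest _ _ t ht).1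
        omega
      have h2 : (r * g).coeff x = 0 := by
        apply hzero
        intro hx'
        obtain ⟨s, hs, t, ht, hl⟩ := hmul _ _ _ hx'
        have := hr s hs
        have := hmax t ht
        omega
      have h3 : (Q * rest (l a + D) h).coeff x = 0 := by
        apply hzero
        intro hx'
        obtain ⟨s, hs, t, ht, hl⟩ := hmul _ _ _ hx'
        have := hQ s hs
        have := (hrest _ _ t ht).1
        omega
      rw [h1, h2, h3] at ex
      simpa using ex
    · have h1 : (single a 1 * comp D g).coeff x = 0 := by
        apply hzero
        intro hx'
        obtain ⟨s, hs, t, ht, hl⟩ := hmul _ _ _ hx'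
        rw [hsingle s hs] at hl
        have := (hcomp _ _ t ht).1
        omega
      have h3 : (Q * comp (l a + D) h).coeff x = 0 := by
        apply hzero
        intro hx'
        obtain ⟨s, hs, t, ht, hl⟩ := hmul _ _ _ hx'
        have := hQ s hs
        have := (hcomp _ _ t ht).1
        omega
      rw [h1, h3]
  have hunit : single (-a) (1 : K) * single a 1 = 1 := by
    rw [single_mul_single, neg_add_cancel, one_mul]; rfl
  have hD : comp D g = Q * (single (-a) 1 * comp (l a + D) h) := by
    calc comp D g = (single (-a) (1 : K) * single a 1) * comp D g := by rw [hunit, one_mul]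
      _ = _ := by rw [mul_assoc, key]; ring
  have hlt : (rest D g).coeff.support.card < c := by
    rw [← hc]
    apply Finset.card_lt_card
    refine ⟨fun x hx => (hrest _ _ x hx).2, fun hsub => (hrest _ _ _ (hsub hx₀)).1 rfl⟩
  -- As `e^a` is a unit, `Q` divides the top component of `g`; removing that component shrinks the
  -- support and changes the cofactor `h` accordingly.
  have := ih _ hlt (rest D g) (h - (single a 1 + r) * (single (-a) 1 * comp (l a + D) h)) (by
    have h1 : rest D g = g - comp D g := eq_sub_of_add_eq' (hsplit D g)
    rw [h1, mul_sub, e, hD]; ring) rfl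
  rw [← hsplit D g]
  exact dvd_add ⟨_, hD⟩ this

/-- Multiplication by `1 + e^v` widens the `l`-range of the support by at least `l v`. -/
lemma width_of_one_add_mul (l : G →+ ℤ) (v : G) (hv : 0 < l v) (W : ℤ)
    (h : AddMonoidAlgebra K G)
    (hW : ∀ x ∈ ((1 + single v 1) * h).coeff.support,
      ∀ y ∈ ((1 + single v 1) * h).coeff.support, l x - l y ≤ W) :
    ∀ x ∈ h.coeff.support, ∀ y ∈ h.coeff.support, l x - l y ≤ W - l v := by
  have hco (x : G) : ((1 + single v 1) * h).coeff x = h.coeff x + h.coeff (x - v) := by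
    rw [add_mul, one_mul, coeff_add, Finsupp.add_apply, AddMonoidAlgebra.coeff_single_mul_apply]
    simp [sub_eq_neg_add]
  intro x hx y hy
  obtain ⟨x₀, hx₀, hmax⟩ := Finset.exists_max_image h.coeff.support l ⟨x, hx⟩
  obtain ⟨y₀, hy₀, hmin⟩ := Finset.exists_min_image h.coeff.support l ⟨x, hx⟩
  -- No cancellation occurs at the two ends: the product has the coefficient of `x₀` at `x₀ + v` and
  -- that of `y₀` at `y₀`.
  have h1 : h.coeff (x₀ + v) = 0 := by
    by_contra hne
    have := hmax _ (Finsupp.mem_support_iff.2 hne)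
    rw [map_add] at this
    omega
  have h2 : h.coeff (y₀ - v) = 0 := by
    by_contra hne
    have := hmin _ (Finsupp.mem_support_iff.2 hne)
    rw [map_sub] at this
    omega
  have h3 := hW (x₀ + v) (by
    rw [Finsupp.mem_support_iff, hco, h1, add_sub_cancel_right, zero_add]
    exact Finsupp.mem_support_iff.1 hx₀) y₀ (by
    rw [Finsupp.mem_support_iff, hco, h2, add_zero]
    exact Finsupp.mem_support_iff.1 hy₀)
  rw [map_add] at h3
  have := hmax x hx
  have := hmin y hy
  omega

lemma eq_zero_of_forall_one_add_pow_dvd (l : G →+ ℤ) (v : G) (hv : 0 < l v)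
    (g : AddMonoidAlgebra K G) (hg : ∀ s : ℕ, (1 + single v 1) ^ s ∣ g) : g = 0 := by
  have key (s : ℕ) : ∀ (W : ℤ) (h : AddMonoidAlgebra K G),
      (∀ x ∈ ((1 + single v 1) ^ s * h).coeff.support,
        ∀ y ∈ ((1 + single v 1) ^ s * h).coeff.support, l x - l y ≤ W) →
      ∀ x ∈ h.coeff.support, ∀ y ∈ h.coeff.support, l x - l y ≤ W - s * l v := by
    induction s with
    | zero => intro W h hW; simpa using hW
    | succ s ih =>
      intro W h hW x hx y hy
      rw [pow_succ, mul_assoc] at hW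
      have := width_of_one_add_mul l v hv _ h (ih W _ hW) x hx y hy
      push_cast
      linarith
  obtain ⟨W, hW⟩ : ∃ W : ℕ, ∀ x ∈ g.coeff.support, ∀ y ∈ g.coeff.support, l x - l y ≤ W := by
    let T := g.coeff.support.sup fun x => g.coeff.support.sup fun y => (l x - l y).toNat
    refine ⟨T, fun x hx y hy => (Int.self_le_toNat _).trans ?_⟩
    have h1 := Finset.le_sup (f := fun y => (l x - l y).toNat) hy
    have h2 := Finset.le_sup (f := fun x => g.coeff.support.sup fun y => (l x - l y).toNat) hx
    exact_mod_cast h1.trans h2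
  -- As `l v ≥ 1`, `W + 1` factors would leave the cofactor with negative width, which is impossible
  -- for a nonempty support.
  obtain ⟨h, rfl⟩ := hg (W + 1)
  by_contra hne
  have hh : h.coeff.support.Nonempty := by
    rw [Finsupp.support_nonempty_iff]
    intro h0
    rw [coeff_eq_zero] at h0
    exact hne (by rw [h0, mul_zero])
  obtain ⟨x, hx⟩ := hh
  have := key (W + 1) W h hW x hx x hx
  push_cast at this
  nlinarith

end GroupRing

/-! ### Laurent rings inside a field, and regularity modulo an element. -/

section Laurent

variable {K F I : Type*} [CommRing K] [Field F] [Algebra K F]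

variable (K) in
/-- The ring of Laurent polynomials in the elements `z i`, inside the field `F`. -/
def laurentSubalgebra (z : I → F) : Subalgebra K F :=
  Algebra.adjoin K (Set.range z ∪ Set.range fun i => (z i)⁻¹)

lemma gen_mem (z : I → F) (i : I) : z i ∈ laurentSubalgebra K z :=
  Algebra.subset_adjoin (Or.inl ⟨i, rfl⟩)

lemma gen_inv_mem (z : I → F) (i : I) : (z i)⁻¹ ∈ laurentSubalgebra K z :=
  Algebra.subset_adjoin (Or.inr ⟨i, rfl⟩)

lemma laurentSubalgebra_le {z : I → F} {R : Subalgebra K F} (h : ∀ i, z i ∈ R)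
    (h' : ∀ i, (z i)⁻¹ ∈ R) : laurentSubalgebra K z ≤ R := by
  apply Algebra.adjoin_le
  rintro _ (⟨i, rfl⟩ | ⟨i, rfl⟩)
  exacts [h i, h' i]

lemma zpow_mem_of_inv_mem {R : Subalgebra K F} {x : F} (h : x ∈ R) (h' : x⁻¹ ∈ R) (a : ℤ) :
    x ^ a ∈ R := by
  cases a with
  | ofNat a => simpa using pow_mem h a
  | negSucc a => simpa using pow_mem h' (a + 1)

variable [Fintype I]

/-- The Laurent monomial with exponent vector `u` in the elements `z i`. -/
def mon (z : I → F) (u : I → ℤ) : F := ∏ i, z i ^ u i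

lemma mon_add {z : I → F} (hz : ∀ i, z i ≠ 0) (u v : I → ℤ) :
    mon z (u + v) = mon z u * mon z v := by
  simp only [mon, ← Finset.prod_mul_distrib, Pi.add_apply]
  exact Finset.prod_congr rfl fun i _ => zpow_add₀ (hz i) _ _

lemma mon_zero (z : I → F) : mon z 0 = 1 := by simp [mon]

lemma mon_neg (z : I → F) (u : I → ℤ) : mon z (-u) = (mon z u)⁻¹ := by
  simp [mon]

lemma mon_sub {z : I → F} (hz : ∀ i, z i ≠ 0) (u v : I → ℤ) :
    mon z (u - v) = mon z u / mon z v := by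
  rw [sub_eq_add_neg, mon_add hz, mon_neg, div_eq_mul_inv]

lemma mon_ne_zero {z : I → F} (hz : ∀ i, z i ≠ 0) (u : I → ℤ) : mon z u ≠ 0 :=
  Finset.prod_ne_zero_iff.2 fun i _ => zpow_ne_zero _ (hz i)

lemma mon_single [DecidableEq I] (z : I → F) (i : I) (a : ℤ) :
    mon z (Pi.single i a) = z i ^ a := by
  rw [mon, Finset.prod_eq_single i]
  · simp
  · intro j _ hj; simp [hj]
  · simp

lemma mon_smul (z : I → F) (u : I → ℤ) (b : ℕ) : mon z ((b : ℤ) • u) = mon z u ^ b := by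
  simp only [mon, ← Finset.prod_pow, Pi.smul_apply, smul_eq_mul]
  exact Finset.prod_congr rfl fun i _ => by rw [mul_comm, zpow_mul, zpow_natCast]

lemma mon_congr {z z' : I → F} {u : I → ℤ} (h : ∀ i, u i ≠ 0 → z i = z' i) :
    mon z u = mon z' u := by
  refine Finset.prod_congr rfl fun i _ => ?_
  by_cases hi : u i = 0
  · simp [hi]
  · rw [h i hi]

lemma mon_mem_of {R : Subalgebra K F} {z : I → F} {u : I → ℤ} (h : ∀ i, u i ≠ 0 → z i ∈ R)
    (h' : ∀ i, u i < 0 → (z i)⁻¹ ∈ R) : mon z u ∈ R := by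
  refine prod_mem fun i _ => ?_
  rcases lt_trichotomy (u i) 0 with hi | hi | hi
  · exact zpow_mem_of_inv_mem (h i hi.ne) (h' i hi) _
  · simp [hi]
  · have hz := h i hi.ne'
    lift u i to ℕ using hi.le with b
    simpa using pow_mem hz b

lemma mon_mem (z : I → F) (u : I → ℤ) : mon z u ∈ laurentSubalgebra K z :=
  mon_mem_of (fun i _ => gen_mem z i) fun i _ => gen_inv_mem z i

variable (K) in
/-- Distinct Laurent monomials in the elements `z i` are linearly independent. -/
def IsFree (z : I → F) : Prop := LinearIndependent K (mon z)

lemma IsFree.ne_zero [Nontrivial K] {z : I → F} (h : IsFree K z) (i : I) : z i ≠ 0 := by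
  classical
  have := LinearIndependent.ne_zero (Pi.single i (1 : ℤ)) h
  rwa [mon_single, zpow_one] at this

/-- Evaluation of elements of the group ring of `I → ℤ` at the elements `z i`. -/
def evalHom (z : I → F) (hz : ∀ i, z i ≠ 0) : AddMonoidAlgebra K (I → ℤ) →ₐ[K] F :=
  AddMonoidAlgebra.lift K F (I → ℤ)
    { toFun := fun u => mon z u.toAdd
      map_one' := mon_zero z
      map_mul' := fun u v => mon_add hz u.toAdd v.toAdd }

lemma evalHom_single (z : I → F) (hz : ∀ i, z i ≠ 0) (u : I → ℤ) (c : K) :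
    evalHom z hz (.single u c) = c • mon z u := by
  simp [evalHom, AddMonoidAlgebra.lift_single]

lemma evalHom_eq (z : I → F) (hz : ∀ i, z i ≠ 0) (g : AddMonoidAlgebra K (I → ℤ)) :
    evalHom z hz g = Finsupp.linearCombination K (mon z) g.coeff := by
  rw [evalHom, AddMonoidAlgebra.lift_apply, Finsupp.linearCombination_apply]
  rfl

lemma IsFree.evalHom_injective {z : I → F} (h : IsFree K z) (hz : ∀ i, z i ≠ 0) :
    Function.Injective (evalHom (K := K) z hz) := by
  intro g g' e
  rw [evalHom_eq, evalHom_eq] at e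
  exact AddMonoidAlgebra.coeff_injective (h e)

lemma evalHom_mem (z : I → F) (hz : ∀ i, z i ≠ 0) (g : AddMonoidAlgebra K (I → ℤ)) :
    evalHom z hz g ∈ laurentSubalgebra K z := by
  rw [evalHom_eq, Finsupp.linearCombination_apply]
  exact Subalgebra.sum_mem _ fun u _ => Subalgebra.smul_mem _ (mon_mem z u) _

lemma exists_evalHom {z : I → F} (hz : ∀ i, z i ≠ 0) {y : F} (hy : y ∈ laurentSubalgebra K z) :
    ∃ g, evalHom (K := K) z hz g = y := by
  classical
  have : laurentSubalgebra K z ≤ (evalHom (K := K) z hz).range := by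
    apply laurentSubalgebra_le
    · exact fun i => ⟨.single (Pi.single i 1) 1, by
        change evalHom z hz _ = _
        rw [evalHom_single, mon_single, one_smul, zpow_one]⟩
    · exact fun i => ⟨.single (Pi.single i (-1)) 1, by
        change evalHom z hz _ = _
        rw [evalHom_single, mon_single, one_smul, zpow_neg_one]⟩
  exact this hy

/-- `f` is a nonzerodivisor modulo `Q` in the subalgebra `R` of the field `F`. -/
def IsRegularMod (R : Subalgebra K F) (Q f : F) : Prop := ∀ g ∈ R, f * g / Q ∈ R → g / Q ∈ R

lemma IsRegularMod.mul {R : Subalgebra K F} {Q f f' : F} (h : IsRegularMod R Q f)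
    (h' : IsRegularMod R Q f') (hf' : f' ∈ R) : IsRegularMod R Q (f * f') := fun g hg e =>
  h' g hg (h _ (mul_mem hf' hg) (by rwa [← mul_assoc]))

/-- Modulo `Q`, multiplication by `f` agrees with multiplication by the invertible `m`. -/
lemma isRegularMod_of_sub {R : Subalgebra K F} {Q f m : F} (hm : m⁻¹ ∈ R) (hm0 : m ≠ 0)
    (h : (f - m) / Q ∈ R) : IsRegularMod R Q f := by
  intro g hg e
  have h1 : m * g / Q = f * g / Q - (f - m) / Q * g := by ring
  have h2 : g / Q = m⁻¹ * (m * g / Q) := by field_simp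
  rw [h2, h1]
  exact mul_mem hm (sub_mem e (mul_mem h hg))

lemma isRegularMod_unit {R : Subalgebra K F} {Q m : F} (hm : m⁻¹ ∈ R) (hm0 : m ≠ 0) :
    IsRegularMod R Q m :=
  isRegularMod_of_sub hm hm0 (by simp)

lemma IsRegularMod.of_unit_mul {R : Subalgebra K F} {Q f m : F} (h : IsRegularMod R Q f)
    (hm : m ∈ R) (hm' : m⁻¹ ∈ R) (hm0 : m ≠ 0) : IsRegularMod R (m * Q) f := by
  intro g hg e
  have h1 : f * g / Q = m * (f * g / (m * Q)) := by field_simp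
  have h2 : g / (m * Q) = m⁻¹ * (g / Q) := by field_simp
  rw [h2]
  exact mul_mem hm' (h g hg (h1 ▸ mul_mem hm e))

/-- If `y` becomes an element of `R` after multiplication by powers of `Q`, respectively of `f`, and
`f` is regular modulo `Q`, then `y` is an element of `R`. -/
lemma IsRegularMod.mem {R : Subalgebra K F} {Q f : F} (h : IsRegularMod R Q f) (hQ : Q ∈ R)
    (hQ0 : Q ≠ 0) (hf : f ∈ R) {y : F} {M N : ℕ} (hM : y * f ^ M ∈ R) (hN : y * Q ^ N ∈ R) :
    y ∈ R := by
  have one (N : ℕ) (y : F) (h1 : y * f ∈ R) (h2 : y * Q ^ N ∈ R) : y ∈ R := by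
    induction N with
    | zero => simpa using h2
    | succ N ih =>
      apply ih
      have h3 : y * Q ^ N = y * Q ^ (N + 1) / Q := by rw [pow_succ]; field_simp
      rw [h3]
      apply h _ h2
      -- Regularity removes one factor `Q` at a time, once a single factor `f` suffices to clear
      -- `y`.
      have h4 : f * (y * Q ^ (N + 1)) / Q = y * f * Q ^ N := by rw [pow_succ]; field_simp
      rw [h4]
      exact mul_mem h1 (pow_mem hQ N)
  induction M with
  | zero => simpa using hM
  | succ M ih =>
    apply ih
    refine one N _ ?_ ?_
    · rwa [mul_assoc, ← pow_succ]
    · rw [mul_right_comm]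
      exact mul_mem hN (pow_mem hf M)

/-- The elements that lie in `R` up to multiplication with a power of `f ∈ R`. -/
def localizedSubalgebra (R : Subalgebra K F) (f : F) (hf : f ∈ R) : Subalgebra K F where
  carrier := {y | ∃ N : ℕ, y * f ^ N ∈ R}
  mul_mem' := by
    rintro a b ⟨N, hN⟩ ⟨M, hM⟩
    refine ⟨N + M, ?_⟩
    have : a * b * f ^ (N + M) = (a * f ^ N) * (b * f ^ M) := by rw [pow_add]; ring
    rw [this]
    exact mul_mem hN hM
  add_mem' := by
    rintro a b ⟨N, hN⟩ ⟨M, hM⟩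
    refine ⟨N + M, ?_⟩
    have : (a + b) * f ^ (N + M) = (a * f ^ N) * f ^ M + (b * f ^ M) * f ^ N := by
      rw [pow_add]; ring
    rw [this]
    exact add_mem (mul_mem hN (pow_mem hf _)) (mul_mem hM (pow_mem hf _))
  algebraMap_mem' := fun r => ⟨0, by simp⟩

lemma le_localizedSubalgebra (R : Subalgebra K F) (f : F) (hf : f ∈ R) :
    R ≤ localizedSubalgebra R f hf := fun y hy => ⟨0, by simpa using hy⟩

/-- An element with top `l`-homogeneous component a monomial is regular modulo every `Q` that is
homogeneous of `l`-degree `0`. -/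
lemma isRegularMod_of_top [Nontrivial K] {z : I → F} (hz : IsFree K z) (l : (I → ℤ) →+ ℤ)
    (a : I → ℤ) {f r Q : F} (hf : f = mon z a + r) (hr : r ∈ Submodule.span K (mon z '' {u | l u < l a}))
    (hQ : Q ∈ Submodule.span K (mon z '' {u | l u = 0})) (hQ0 : Q ≠ 0) :
    IsRegularMod (laurentSubalgebra K z) Q f := by
  intro g hg e
  obtain ⟨r', hr', rfl⟩ := (Finsupp.mem_span_image_iff_linearCombination K).1 hr
  obtain ⟨Q', hQ', rfl⟩ := (Finsupp.mem_span_image_iff_linearCombination K).1 hQ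
  obtain ⟨g, rfl⟩ := exists_evalHom hz.ne_zero hg
  obtain ⟨h, hh⟩ := exists_evalHom hz.ne_zero e
  have hev (x : (I → ℤ) →₀ K) : Finsupp.linearCombination K (mon z) x
      = evalHom z hz.ne_zero (.ofCoeff x) := (evalHom_eq z hz.ne_zero (.ofCoeff x)).symm
  have ha : mon z a = evalHom (K := K) z hz.ne_zero (.single a 1) := by
    rw [evalHom_single, one_smul]
  rw [eq_div_iff hQ0, hf, hev, hev, ha, ← map_add, ← map_mul, ← map_mul] at hh
  have := hz.evalHom_injective hz.ne_zero hh
  obtain ⟨q, rfl⟩ := dvd_of_dvd_top_mul l a (.ofCoeff r') (.ofCoeff Q')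
    (fun x hx => (Finsupp.mem_supported K r').1 hr' hx)
    (fun x hx => (Finsupp.mem_supported K Q').1 hQ' hx) g h (by rw [← this, mul_comm])
  rw [hev] at hQ0
  rw [hev, map_mul, mul_div_cancel_left₀ _ hQ0]
  exact evalHom_mem _ _ _

variable (K) in
/-- The combinations of Laurent monomials of nonpositive `l`-degree. -/
def nonposSubalgebra (z : I → F) (hz : ∀ i, z i ≠ 0) (l : (I → ℤ) →+ ℤ) : Subalgebra K F :=
  Submodule.toSubalgebra (Submodule.span K (mon z '' {u | l u ≤ 0}))
    (Submodule.subset_span ⟨0, by simp, mon_zero z⟩) (by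
      intro x y hx hy
      have := Submodule.mul_mem_mul hx hy
      rw [Submodule.span_mul_span] at this
      refine Submodule.span_mono ?_ this
      rintro _ ⟨_, ⟨u, hu, rfl⟩, _, ⟨v, hv, rfl⟩, rfl⟩
      refine ⟨u + v, ?_, mon_add hz u v⟩
      simp only [Set.mem_ofPred_eq, map_add] at *
      omega)

lemma mem_nonposSubalgebra {z : I → F} {hz : ∀ i, z i ≠ 0} {l : (I → ℤ) →+ ℤ} {x : F} :
    x ∈ nonposSubalgebra K z hz l ↔ x ∈ Submodule.span K (mon z '' {u | l u ≤ 0}) := Iff.rfl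

lemma mon_mem_nonpos {z : I → F} {hz : ∀ i, z i ≠ 0} {l : (I → ℤ) →+ ℤ} {u : I → ℤ}
    (hu : l u ≤ 0) : mon z u ∈ nonposSubalgebra K z hz l :=
  Submodule.subset_span ⟨u, hu, rfl⟩

lemma nonposSubalgebra_le {z : I → F} {hz : ∀ i, z i ≠ 0} {l : (I → ℤ) →+ ℤ} :
    nonposSubalgebra K z hz l ≤ laurentSubalgebra K z := by
  intro x hx
  refine (Submodule.span_le (p := Subalgebra.toSubmodule (laurentSubalgebra K z))).2 ?_ hx
  rintro _ ⟨u, -, rfl⟩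
  exact mon_mem z u

end Laurent

/-! ### Linear functionals and sign patterns. -/

section Integers

/-- A linear functional that vanishes on `w` and is positive on `v`. -/
lemma exists_functional {I : Type*} {v w : I → ℤ} (h : ∃ i j, v i * w j ≠ v j * w i) :
    ∃ l : (I → ℤ) →+ ℤ, l w = 0 ∧ 0 < l v := by
  obtain ⟨i, j, hij⟩ := h
  -- The `2 × 2` minor with second column `w`; the sign of the minor of `v` and `w` decides the
  -- order of the rows.
  let f (i j : I) : (I → ℤ) →+ ℤ :=
    w j • Pi.evalAddMonoidHom (fun _ => ℤ) i - w i • Pi.evalAddMonoidHom (fun _ => ℤ) j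
  have hf (i j u) : f i j u = w j * u i - w i * u j := by simp [f]
  rcases lt_or_gt_of_ne hij with h | h
  · exact ⟨f j i, by rw [hf]; ring, by rw [hf]; linarith⟩
  · exact ⟨f i j, by rw [hf]; ring, by rw [hf]; linarith⟩

/-- The possible signs of the entries `b_jk` and `b_kj` of a skew-symmetrizable matrix. -/
lemma zero_or_opposite {a b : ℤ} (h : (a = 0 ↔ b = 0)) (h' : a * b ≤ 0) :
    (a = 0 ∧ b = 0) ∨ (a < 0 ∧ 0 < b) ∨ (0 < a ∧ b < 0) := by
  rcases lt_trichotomy a 0 with ha | ha | ha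
  · rcases lt_trichotomy b 0 with hb | hb | hb
    · nlinarith
    · exact absurd (h.2 hb) ha.ne
    · exact Or.inr (Or.inl ⟨ha, hb⟩)
  · exact Or.inl ⟨ha, h.1 ha⟩
  · rcases lt_trichotomy b 0 with hb | hb | hb
    · exact Or.inr (Or.inr ⟨ha, hb⟩)
    · exact absurd (h.2 hb) ha.ne'
    · nlinarith

end Integers

/-! ### Exchange binomials and Laurent rings along a path of mutations. -/

section Exchange

variable {K F I : Type*} [CommRing K] [Field F] [Algebra K F] [Fintype I]

/-- The exchange binomial attached to a column `v` of an extended exchange matrix. -/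
def exch (z : I → F) (v : I → ℤ) : F :=
  mon z (fun i => max (v i) 0) + mon z (fun i => max (-v i) 0)

lemma exch_neg (z : I → F) (v : I → ℤ) : exch z (-v) = exch z v := by
  simp [exch, add_comm]

lemma exch_congr {z z' : I → F} {v : I → ℤ} (h : ∀ i, v i ≠ 0 → z i = z' i) :
    exch z v = exch z' v := by
  unfold exch
  rw [mon_congr (z' := z'), mon_congr (z := z) (z' := z')]
  · exact fun i hi => h i fun h0 => hi (by simp [h0])
  · exact fun i hi => h i fun h0 => hi (by simp [h0])

lemma exch_eq_mul {z : I → F} (hz : ∀ i, z i ≠ 0) (v : I → ℤ) :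
    exch z v = mon z (fun i => max (-v i) 0) * (1 + mon z v) := by
  rw [exch, mul_add, mul_one, ← mon_add hz, add_comm]
  congr 2
  ext i
  rw [Pi.add_apply]
  omega

lemma exch_mem (z : I → F) (v : I → ℤ) : exch z v ∈ laurentSubalgebra K z :=
  add_mem (mon_mem z _) (mon_mem z _)

/-- Up to a unit the binomial is `1 + z^v`. For `v ≠ 0` this is a sum of two independent monomials;
for `v = 0` it is `2`, nonzero in characteristic zero. -/
lemma exch_ne_zero [CharZero K] [IsDomain K] {z : I → F} (hz : IsFree K z) (v : I → ℤ) :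
    exch z v ≠ 0 := by
  rw [exch_eq_mul hz.ne_zero]
  refine mul_ne_zero (mon_ne_zero hz.ne_zero _) fun h => ?_
  rw [← mon_zero z] at h
  have h1 : (1 : K) • mon z 0 + (1 : K) • mon z v = 0 := by simpa using h
  by_cases hv : v = 0
  · subst hv
    rw [← add_smul, one_add_one_eq_two] at h1
    have := (linearIndependent_iff.1 hz) (.single 0 2) (by simpa using h1)
    simp at this
  · have := (linearIndependent_iff.1 hz) (.single 0 1 + .single v 1) (by simpa using h1)
    have h2 := DFunLike.congr_fun this 0
    simp [hv] at h2

variable [Nontrivial K]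

/-- A nonzero Laurent polynomial is not divisible by all powers of an exchange binomial. -/
lemma exists_div_exch_pow_notMem {z : I → F} (hz : IsFree K z) {v : I → ℤ} (hv : v ≠ 0)
    (hv0 : exch z v ≠ 0) {y : F} (hy0 : y ≠ 0) :
    ∃ s : ℕ, y / exch z v ^ s ∉ laurentSubalgebra K z := by
  by_contra! hall
  obtain ⟨i, hi⟩ := Function.ne_iff.1 hv
  have hz' := hz.ne_zero
  obtain ⟨l, hl⟩ : ∃ l : (I → ℤ) →+ ℤ, 0 < l v := by
    rcases lt_or_gt_of_ne hi with h | h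
    · exact ⟨-Pi.evalAddMonoidHom (fun _ => ℤ) i, by simpa using h⟩
    · exact ⟨Pi.evalAddMonoidHom (fun _ => ℤ) i, by simpa using h⟩
  obtain ⟨g, hg⟩ := exists_evalHom hz' (by simpa using hall 0)
  have h1 : (1 + mon z v) = evalHom (K := K) z hz' (1 + .single v 1) := by
    rw [map_add, map_one, evalHom_single, one_smul]
  -- Multiplying the quotient by the unit monomial of `exch_eq_mul` turns division by the binomial
  -- into division by `1 + z^v`.
  have := eq_zero_of_forall_one_add_pow_dvd l v hl g fun s => by
    obtain ⟨h, hh⟩ := exists_evalHom hz' (mul_mem (hall s)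
      (pow_mem (mon_mem (K := K) z (fun i => max (-v i) 0)) s))
    refine ⟨h, hz.evalHom_injective hz' ?_⟩
    rw [map_mul, map_pow, ← h1, hh, hg]
    rw [exch_eq_mul hz'] at hv0 ⊢
    have h2 := left_ne_zero_of_mul hv0
    have h3 := right_ne_zero_of_mul hv0
    rw [mul_pow]
    field_simp
  rw [this, map_zero] at hg
  exact hy0 hg.symm

variable [DecidableEq I]

/-- The two exchange relations of the extremal seeds of a path `t_q — t — t_p — t_{pq}`, written in
the cluster `z₂` of `t_{pq}`: the case of a positive entry `w p`. -/
lemma regular_of_pos {z z₂ : I → F} {p q : I} (hpq : p ≠ q) {v w w' : I → ℤ} {Q : F}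
    (hvp : v p = 0) (hwq : w q = 0) (hvq : v q < 0) (hwp : 0 < w p) (hw'p : w' p = -w p)
    (hw' : ∀ i, i ≠ p → w' i = w i + max (v i) 0 * w p + v i * max (-w p) 0)
    (hz : ∀ i, z i ≠ 0) (hfree : IsFree K z₂)
    (hp : z₂ p = exch z v / z p) (hq : z₂ q = Q / z q) (hQ : Q = exch z₂ w')
    (ho : ∀ i, i ≠ p → i ≠ q → z₂ i = z i) :
    (z p ∈ laurentSubalgebra K z₂ ∧ IsRegularMod (laurentSubalgebra K z₂) Q (z p)) ∧
      exch z w / z q ∈ laurentSubalgebra K z₂ ∧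
        IsRegularMod (laurentSubalgebra K z₂) Q (exch z w / z q) := by
  have hz₂ := hfree.ne_zero
  -- Hence `Q` does not involve `z₂ q`, so it has degree `0` for the grading `l` by the exponent of
  -- `z₂ q`.
  have hw'q : w' q = 0 := by
    rw [hw' q hpq.symm, hwq, max_eq_right hvq.le, max_eq_right (by omega)]; simp
  have hQ0 : Q ≠ 0 := by
    intro h; apply hz₂ q; rw [hq, h, zero_div]
  set l : (I → ℤ) →+ ℤ := Pi.evalAddMonoidHom (fun _ => ℤ) q with hl
  have hl' (u : I → ℤ) : l u = u q := rfl
  set N := nonposSubalgebra K z₂ hz₂ l with hN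
  have hmonN (u : I → ℤ) (hu : u q ≤ 0) : mon z₂ u ∈ N := mon_mem_nonpos hu
  have hQspan : Q ∈ Submodule.span K (mon z₂ '' {u | l u = 0}) := by
    rw [hQ]
    refine add_mem (Submodule.subset_span ⟨_, ?_, rfl⟩) (Submodule.subset_span ⟨_, ?_, rfl⟩) <;>
    simp [hl', hw'q]
  have hQN : Q ∈ N := by
    rw [hQ]
    exact add_mem (hmonN _ (by simp [hw'q])) (hmonN _ (by simp [hw'q]))
  have hzq : z q = Q * mon z₂ (Pi.single q (-1)) := by
    rw [mon_single, zpow_neg_one, hq]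
    have := hz q
    field_simp
  have hzqN : z q ∈ N := by
    rw [hzq]
    exact mul_mem hQN (hmonN _ (by simp))
  have hzN (u : I → ℤ) (hup : u p = 0) (huq : 0 ≤ u q) : mon z u ∈ N := by
    apply mon_mem_of
    · intro i hi
      by_cases hiq : i = q
      · exact hiq ▸ hzqN
      · rw [← ho i (fun h => hi (h ▸ hup)) hiq, ← zpow_one (z₂ i), ← mon_single]
        exact hmonN _ (by simp [Ne.symm hiq])
    · intro i hi
      have hiq : i ≠ q := fun h => by subst h; omega
      rw [← ho i (fun h => by subst h; omega) hiq, ← zpow_neg_one (z₂ i), ← mon_single]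
      exact hmonN _ (by simp [Ne.symm hiq])
  have hmoneq (u : I → ℤ) (hup : u p = 0) (huq : u q = 0) : mon z u = mon z₂ u :=
    mon_congr fun i hi => (ho i (fun h => hi (h ▸ hup)) (fun h => hi (h ▸ huq))).symm
  set vP : I → ℤ := fun i => max (v i) 0 with hvP
  set vM : I → ℤ := fun i => max (-v i) 0 with hvM
  set wP : I → ℤ := fun i => max (w i) 0 with hwP
  set wM : I → ℤ := fun i => max (-w i) 0 with hwM
  set α := mon z₂ (vP - Pi.single p 1) with hα
  set β := mon z (vM - Pi.single q 1) * mon z₂ (Pi.single p (-1)) with hβ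
  have hαN : α ∈ N := hmonN _ (by simp [hvP, hpq.symm, hvq.le])
  have hβN : β ∈ N := by
    refine mul_mem (hzN _ ?_ ?_) (hmonN _ ?_)
    · simp [hvM, hvp, hpq]
    · simp only [hvM, Pi.sub_apply, Pi.single_eq_same]; omega
    · simp [hpq.symm]
  -- As `v q < 0`, the variable `z q` occurs only in the second monomial of the exchange relation at
  -- `p`. Since `z q = Q / z₂ q`, the element `z p` is congruent modulo `Q` to the unit `α`.
  have hzp : z p = α + z q * β := by
    have h1 : z p = exch z v / z₂ p := by
      have := hz₂ p
      have := hz p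
      rw [eq_div_iff (hz₂ p), hp]
      field_simp
    have h2 : mon z vM = z q * mon z (vM - Pi.single q 1) := by
      rw [mon_sub hz, mon_single, zpow_one]
      have := hz q
      field_simp
    rw [h1, exch, ← hvP, ← hvM, h2, hα, hβ, mon_sub hz₂, mon_single, mon_single,
      ← hmoneq vP (by simp [hvP, hvp]) (by simp [hvP, hvq.le]), zpow_one, zpow_neg_one]
    ring
  have hzpN : z p ∈ N := hzp ▸ add_mem hαN (mul_mem hzqN hβN)
  obtain ⟨b, hb⟩ : ∃ b : ℕ, w p = b := Int.eq_ofNat_of_zero_le hwp.le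
  obtain ⟨S, hS⟩ := sub_dvd_pow_sub_pow (⟨z p, hzpN⟩ : N) ⟨α, hαN⟩ b
  have hS' : z p ^ b = α ^ b + z q * β * S := by
    have := congrArg (Subtype.val) hS
    push_cast at this
    rw [sub_eq_iff_eq_add, add_comm] at this
    rw [this, hzp]; ring
  set wP' := wP - Pi.single p (b : ℤ) with hwP'
  have hwP'p : wP' p = 0 := by simp [hwP', hwP, hb]
  have hwP'q : wP' q = 0 := by simp [hwP', hwP, hwq, hpq.symm]
  have hexch : exch z w = z p ^ b * mon z wP' + mon z wM := by
    rw [exch, ← hwP, ← hwM, hwP', mon_sub hz, mon_single, zpow_natCast]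
    have := hz p
    field_simp
  set c : I → ℤ := wM - fun i => max (-w' i) 0 with hc
  -- Replacing `z p` by `α` in the binomial of `w` gives a monomial times `Q`: the rule for `w'`
  -- says exactly that the exponent vectors match.
  have hmain : α ^ b * mon z wP' + mon z wM = mon z₂ c * Q := by
    rw [hmoneq wP' hwP'p hwP'q, hmoneq wM (by simp [hwM, hwp.le]) (by simp [hwM, hwq]), hα,
      ← mon_smul, ← mon_add hz₂, hQ, exch, mul_add, ← mon_add hz₂, ← mon_add hz₂]
    congr 2
    · ext i
      by_cases hi : i = p
      · subst hi
        simp only [hvP, hvp, hwP', hwP, hc, hwM, hw'p, Pi.add_apply, Pi.smul_apply, Pi.sub_apply,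
          Pi.single_eq_same, smul_eq_mul, hb]
        simp
      · have h1 := hw' i hi
        rw [max_eq_right (by omega : -w p ≤ 0), mul_zero, add_zero, hb] at h1
        simp only [hvP, hwP', hwP, hc, hwM, Pi.add_apply, Pi.smul_apply, Pi.sub_apply,
          Pi.single_eq_of_ne hi, smul_eq_mul]
        rw [mul_comm] at h1
        rw [sub_zero, sub_zero]
        omega
    · ext i
      simp [hc]
  -- Division by `z q = Q / z₂ q` leaves a monomial of degree `1` in `z₂ q` plus terms of degree at
  -- most `0`, so the top component is a monomial.
  have hx : exch z w / z q = mon z₂ (c + Pi.single q 1) + β * S * mon z wP' := by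
    have h1 : exch z w = mon z₂ c * Q + z q * β * S * mon z wP' := by
      rw [← hmain, hexch, hS']; ring
    rw [h1, mon_add hz₂, mon_single, zpow_one, hq]
    have := hz q
    field_simp
  have hhN : β * S * mon z wP' ∈ N :=
    mul_mem (mul_mem hβN S.2) (hzN _ hwP'p hwP'q.ge)
  have hcq : c q = 0 := by simp [hc, hwM, hwq, hw'q]
  refine ⟨⟨nonposSubalgebra_le hzpN, ?_⟩, ?_, ?_⟩
  · refine isRegularMod_of_sub (m := α) ?_ (mon_ne_zero hz₂ _) ?_
    · rw [hα, ← mon_neg]; exact mon_mem _ _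
    · rw [hzp, hzq]
      have : (α + Q * mon z₂ (Pi.single q (-1)) * β - α) / Q = mon z₂ (Pi.single q (-1)) * β := by
        field_simp; ring
      rw [this]
      exact mul_mem (mon_mem _ _) (nonposSubalgebra_le hβN)
  · rw [hx]
    exact add_mem (mon_mem _ _) (nonposSubalgebra_le hhN)
  · refine isRegularMod_of_top hfree l _ hx ?_ hQspan hQ0
    refine Submodule.span_mono ?_ (mem_nonposSubalgebra.1 hhN)
    refine Set.image_mono fun u hu => ?_
    have h1 : l (c + Pi.single q 1) = 1 := by simp [hl', hcq]
    rw [Set.mem_ofPred_eq, h1]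
    exact Int.lt_add_one_of_le hu

/-- The two exchanges do not interact. Up to monomials, `z p` and `Q` are the binomials of `v` and
`w` in `z₂`; a functional killing `w` and positive on `v` singles out a top monomial of `z p`, while
`exch z w / z q` is the unit `z₂ q`. -/
lemma regular_of_zero {z z₂ : I → F} {p q : I} {v w : I → ℤ} {Q : F}
    (hvp : v p = 0) (hwq : w q = 0) (hvq : v q = 0) (hwp : w p = 0)
    (hind : ∃ i j, v i * w j ≠ v j * w i)
    (hz : ∀ i, z i ≠ 0) (hfree : IsFree K z₂)
    (hp : z₂ p = exch z v / z p) (hq : z₂ q = Q / z q) (hQ : Q = exch z₂ w)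
    (ho : ∀ i, i ≠ p → i ≠ q → z₂ i = z i) :
    (z p ∈ laurentSubalgebra K z₂ ∧ IsRegularMod (laurentSubalgebra K z₂) Q (z p)) ∧
      exch z w / z q ∈ laurentSubalgebra K z₂ ∧
        IsRegularMod (laurentSubalgebra K z₂) Q (exch z w / z q) := by
  have hz₂ := hfree.ne_zero
  have hQ0 : Q ≠ 0 := by
    intro h; apply hz₂ q; rw [hq, h, zero_div]
  obtain ⟨l, hlw, hlv⟩ := exists_functional hind
  have hex (u : I → ℤ) (hup : u p = 0) (huq : u q = 0) : exch z u = exch z₂ u :=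
    exch_congr fun i hi => (ho i (fun h => hi (h ▸ hup)) (fun h => hi (h ▸ huq))).symm
  have hzp : z p = mon z₂ ((fun i => max (v i) 0) - Pi.single p 1)
      + mon z₂ ((fun i => max (-v i) 0) - Pi.single p 1) := by
    rw [mon_sub hz₂, mon_sub hz₂, ← add_div, ← exch, ← hex v hvp hvq, mon_single, zpow_one,
      eq_div_iff (hz₂ p), hp]
    have := hz p
    field_simp
  have hxq : exch z w / z q = z₂ q := by rw [hex w hwp hwq, ← hQ, hq]
  refine ⟨⟨?_, ?_⟩, ?_, ?_⟩
  · rw [hzp]; exact add_mem (mon_mem _ _) (mon_mem _ _)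
  · rw [hQ, exch_eq_mul hz₂]
    refine IsRegularMod.of_unit_mul ?_ (mon_mem _ _) (by rw [← mon_neg]; exact mon_mem _ _)
      (mon_ne_zero hz₂ _)
    refine isRegularMod_of_top hfree l _ hzp (Submodule.subset_span ⟨_, ?_, rfl⟩) ?_ ?_
    · have : v = (fun i => max (v i) 0) - (fun i => max (-v i) 0) := by
        ext i; rw [Pi.sub_apply]; omega
      rw [this, map_sub] at hlv
      rw [Set.mem_ofPred_eq, map_sub, map_sub]
      omega
    · refine add_mem (Submodule.subset_span ⟨0, ?_, mon_zero _⟩)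
        (Submodule.subset_span ⟨w, hlw, rfl⟩)
      simp
    · intro h
      rw [hQ, exch_eq_mul hz₂, h, mul_zero] at hQ0
      exact hQ0 rfl
  · rw [hxq]; exact gen_mem _ _
  · rw [hxq]; exact isRegularMod_unit (gen_inv_mem _ _) (hz₂ q)

/-- The tuple obtained from `z` by the exchange relation `z k * z' k = exch z v`. -/
def mutTuple (z : I → F) (v : I → ℤ) (k : I) : I → F := Function.update z k (exch z v / z k)

/-- Along a path `t_q — t — t_p — t_{pq}` of clusters, an element that is a Laurent polynomial in
the clusters at `t_q` and `t_p` is a Laurent polynomial in the cluster at `t_{pq}`. -/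
theorem mem_laurentSubalgebra_of_path {z : I → F} {p q : I} (hpq : p ≠ q) {v w w' : I → ℤ}
    (hvp : v p = 0) (hwq : w q = 0) (hzero : v q = 0 ↔ w p = 0) (hsign : v q * w p ≤ 0)
    (hw'p : w' p = -w p)
    (hw' : ∀ i, i ≠ p → w' i = w i + max (v i) 0 * w p + v i * max (-w p) 0)
    (hind : ∃ i j, v i * w j ≠ v j * w i)
    (hz : ∀ i, z i ≠ 0) (hzw : exch z w ≠ 0)
    (hfree : IsFree K (mutTuple (mutTuple z v p) w' q)) {y : F}
    (hy : y ∈ laurentSubalgebra K (mutTuple z v p))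
    (hy' : y ∈ laurentSubalgebra K (mutTuple z w q)) :
    y ∈ laurentSubalgebra K (mutTuple (mutTuple z v p) w' q) := by
  set z₂ := mutTuple (mutTuple z v p) w' q with hz₂def
  have hz₂ := hfree.ne_zero
  set Q := exch (mutTuple z v p) w' with hQdef
  set R := laurentSubalgebra K z₂ with hR
  have hp : z₂ p = exch z v / z p := by
    simp [hz₂def, mutTuple, hpq]
  have hq : z₂ q = Q / z q := by
    simp [hz₂def, mutTuple, hpq.symm, hQdef]
  have ho (i : I) (hip : i ≠ p) (hiq : i ≠ q) : z₂ i = z i := by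
    simp [hz₂def, mutTuple, hip, hiq]
  have hcases := zero_or_opposite hzero hsign
  have hw'q : w' q = 0 := by
    rw [hw' q hpq.symm, hwq]
    rcases hcases with ⟨h1, h2⟩ | ⟨h1, h2⟩ | ⟨h1, h2⟩
    · simp [h1, h2]
    · rw [max_eq_right h1.le, max_eq_right (by omega)]; simp
    · rw [max_eq_left h1.le, max_eq_left (by omega)]; simp
  have hQ : Q = exch z₂ w' := by
    refine exch_congr fun i hi => ?_
    have : i ≠ q := fun h => hi (h ▸ hw'q)
    simp [hz₂def, mutTuple, this]
  have hQ0 : Q ≠ 0 := by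
    intro h; apply hz₂ q; rw [hq, h, zero_div]
  have hreg : (z p ∈ R ∧ IsRegularMod R Q (z p)) ∧
      exch z w / z q ∈ R ∧ IsRegularMod R Q (exch z w / z q) := by
    rcases hcases with ⟨h1, h2⟩ | ⟨h1, h2⟩ | ⟨h1, h2⟩
    · have : w' = w := by
        ext i
        by_cases hi : i = p
        · rw [hi, hw'p, h2, neg_zero]
        · rw [hw' i hi, h2]; simp
      exact regular_of_zero hvp hwq h1 h2 hind hz hfree hp hq (this ▸ hQ) ho
    · exact regular_of_pos hpq hvp hwq h1 h2 hw'p hw' hz hfree hp hq hQ ho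
    -- Negating all columns exchanges the two monomials of each binomial and reduces to a positive
    -- entry at `p`. The mutation rule survives since `v i` is the difference of its positive and
    -- negative parts.
    · rw [← exch_neg z w]
      rw [← exch_neg] at hp hQ
      refine regular_of_pos hpq (v := -v) (w := -w) (w' := -w') (by simp [hvp]) (by simp [hwq])
        (by simpa using h1) (by simpa using h2) (by simp [hw'p]) (fun i hi => ?_)
        hz hfree hp hq hQ ho
      simp only [Pi.neg_apply, hw' i hi, neg_neg]
      rw [max_eq_left (by omega : 0 ≤ -w p), max_eq_right h2.le]
      have h3 : v i = max (v i) 0 - max (-v i) 0 := by omega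
      linear_combination (w p) * h3
  obtain ⟨⟨hzp, hzpreg⟩, hx, hxreg⟩ := hreg
  have hQR : Q ∈ R := hQ ▸ exch_mem z₂ w'
  -- The clusters at `t_p` and `t_{pq}` differ only at `q`, where `z q = Q / z₂ q`; inverting it
  -- costs one factor `Q`.
  have hN : y ∈ localizedSubalgebra R Q hQR := by
    refine laurentSubalgebra_le ?_ ?_ hy
    · intro i
      by_cases hi : i = q
      · subst hi
        apply le_localizedSubalgebra
        have : mutTuple z v p i = Q * (z₂ i)⁻¹ := by
          rw [hq]
          have := hz i
          simp only [mutTuple, Function.update_of_ne hpq.symm]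
          field_simp
        rw [this]
        exact mul_mem hQR (gen_inv_mem _ _)
      · apply le_localizedSubalgebra
        have : mutTuple z v p i = z₂ i := by simp [hz₂def, mutTuple, hi]
        rw [this]
        exact gen_mem _ _
    · intro i
      by_cases hi : i = q
      · subst hi
        refine ⟨1, ?_⟩
        have : (mutTuple z v p i)⁻¹ * Q ^ 1 = z₂ i := by
          rw [hq]
          have := hz i
          simp only [mutTuple, Function.update_of_ne hpq.symm]
          field_simp
        rw [this]
        exact gen_mem _ _
      · apply le_localizedSubalgebra
        have : mutTuple z v p i = z₂ i := by simp [hz₂def, mutTuple, hi]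
        rw [this]
        exact gen_inv_mem _ _
  have hfR : z p * (exch z w / z q) ∈ R := mul_mem hzp hx
  -- The only generators at `t_q` whose inverses may leave `R` are the two factors of this product,
  -- and each is cleared by the product because the other factor lies in `R`.
  have hM : y ∈ localizedSubalgebra R (z p * (exch z w / z q)) hfR := by
    refine laurentSubalgebra_le ?_ ?_ hy'
    · intro i
      apply le_localizedSubalgebra
      by_cases hi : i = q
      · subst hi
        simpa [mutTuple] using hx
      · simp only [mutTuple, Function.update_of_ne hi]
        by_cases hi' : i = p
        · exact hi' ▸ hzp
        · rw [← ho i hi' hi]; exact gen_mem _ _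
    · intro i
      by_cases hi : i = q
      · subst hi
        refine ⟨1, ?_⟩
        have : (mutTuple z w i i)⁻¹ * (z p * (exch z w / z i)) ^ 1 = z p := by
          have := hz i
          simp only [mutTuple, Function.update_self]
          field_simp
        rw [this]
        exact hzp
      · simp only [mutTuple, Function.update_of_ne hi]
        by_cases hi' : i = p
        · subst hi'
          refine ⟨1, ?_⟩
          have : (z i)⁻¹ * (z i * (exch z w / z q)) ^ 1 = exch z w / z q := by
            have := hz i
            field_simp
          rw [this]
          exact hx
        · apply le_localizedSubalgebra
          rw [← ho i hi' hi]; exact gen_inv_mem _ _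
  obtain ⟨N, hN⟩ := hN
  obtain ⟨M, hM⟩ := hM
  exact (hzpreg.mul hxreg hx).mem hQR hQ0 hfR hM hN

end Exchange

/-! ### Mutation of skew-symmetrizable matrices. -/

section Integers

lemma sign_mul_max_mul (a b : ℤ) :
    a.sign * max (a * b) 0 = max a 0 * b + a * max (-b) 0 := by
  rcases lt_trichotomy a 0 with ha | rfl | ha
  · rw [Int.sign_eq_neg_one_of_neg ha, max_eq_right ha.le]
    rcases le_total b 0 with hb | hb
    · rw [max_eq_left (mul_nonneg_of_nonpos_of_nonpos ha.le hb), max_eq_left (by omega)]; ring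
    · rw [max_eq_right (mul_nonpos_of_nonpos_of_nonneg ha.le hb), max_eq_right (by omega)]; ring
  · simp
  · rw [Int.sign_eq_one_of_pos ha, max_eq_left ha.le]
    rcases le_total b 0 with hb | hb
    · rw [max_eq_right (mul_nonpos_of_nonneg_of_nonpos ha.le hb), max_eq_left (by omega)]; ring
    · rw [max_eq_left (mul_nonneg ha.le hb), max_eq_right (by omega)]; ring

/-- Brings tropical coefficient mutation to the form of matrix mutation, so that the rows of `C`
mutate like those of `B`. -/
lemma max_mul_add_neg_mul_min (b c : ℤ) :
    max b 0 * c + -b * min 0 c = max c 0 * b + c * max (-b) 0 := by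
  rcases le_total b 0 with hb | hb <;> rcases le_total c 0 with hc | hc <;>
  simp [hb, hc] <;> ring

variable {n : ℕ} {B : Matrix (Fin n) (Fin n) ℤ}

lemma mutateMatrix_of_ne {k i j : Fin n} (hi : i ≠ k) (hj : j ≠ k) :
    mutateMatrix B k i j = B i j + max (B i k) 0 * B k j + B i k * max (-B k j) 0 := by
  rw [mutateMatrix, Matrix.of_apply, if_neg (by tauto), sign_mul_max_mul, add_assoc]

lemma mutateMatrix_left (k j : Fin n) : mutateMatrix B k k j = -B k j := by
  simp [mutateMatrix]

lemma mutateMatrix_right (k i : Fin n) : mutateMatrix B k i k = -B i k := by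
  simp [mutateMatrix]

lemma IsSkewSymmetrizable.diag (h : IsSkewSymmetrizable B) (k : Fin n) : B k k = 0 := by
  obtain ⟨s, hs, h⟩ := h
  have := h k k
  have h1 := hs k
  have : s k * B k k = 0 := by omega
  rcases mul_eq_zero.1 this with h | h
  · omega
  · exact h

lemma IsSkewSymmetrizable.eq_zero_iff (h : IsSkewSymmetrizable B) (j k : Fin n) :
    B j k = 0 ↔ B k j = 0 := by
  obtain ⟨s, hs, h⟩ := h
  have h1 := h j k
  constructor <;> intro h0
  · rw [h0, mul_zero, eq_comm, neg_eq_zero] at h1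
    exact (mul_eq_zero.1 h1).resolve_left (hs k).ne'
  · rw [h0, mul_zero, neg_zero] at h1
    exact (mul_eq_zero.1 h1).resolve_left (hs j).ne'

lemma IsSkewSymmetrizable.mul_nonpos (h : IsSkewSymmetrizable B) (j k : Fin n) :
    B j k * B k j ≤ 0 := by
  obtain ⟨s, hs, h⟩ := h
  have h1 := h j k
  have h2 : s j * (B j k * B k j) = -(s k * (B k j * B k j)) := by
    rw [← mul_assoc, h1]; ring
  by_contra! h3
  have h4 := mul_pos (hs j) h3
  have h5 := mul_nonneg (hs k).le (mul_self_nonneg (B k j))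
  linarith

lemma mul_max_zero {s : ℤ} (hs : 0 < s) (a : ℤ) : s * max a 0 = max (s * a) 0 := by
  rw [mul_max_of_nonneg _ _ hs.le, mul_zero]

lemma IsSkewSymmetrizable.mutateMatrix (h : IsSkewSymmetrizable B) (k : Fin n) :
    IsSkewSymmetrizable (mutateMatrix B k) := by
  obtain ⟨s, hs, h⟩ := h
  refine ⟨s, hs, fun i j => ?_⟩
  by_cases hi : i = k
  · subst hi
    rw [mutateMatrix_left, mutateMatrix_right]
    linarith [h i j]
  by_cases hj : j = k
  · subst hj
    rw [mutateMatrix_left, mutateMatrix_right]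
    linarith [h i j]
  rw [mutateMatrix_of_ne hi hj, mutateMatrix_of_ne hj hi]
  have h1 : s i * max (B i k) 0 = s k * max (-B k i) 0 := by
    rw [mul_max_zero (hs i), mul_max_zero (hs k), h i k, mul_neg]
  have h2 : s k * max (-B k j) 0 = s j * max (B j k) 0 := by
    rw [mul_max_zero (hs k), mul_max_zero (hs j), h j k, mul_neg]
  have h3 := h i j
  have h4 := h i k
  have h5 := h k j
  linear_combination h3 + B k j * h1 + max (-B k j) 0 * h4 + max (-B k i) 0 * h5 - B k i * h2

end Integers

/-! ### Algebraic independence under an exchange. -/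

section AlgebraicIndependence

variable {R F : Type*} [CommRing R] [Field F] [Algebra R F]

/-- Replacing a member `A k` of an algebraically independent family by `P / A k`, where `P` is a
polynomial in the other members, gives an algebraically independent family. -/
lemma algebraicIndependent_update_div {ι : Type*} [DecidableEq ι] {A : ι → F}
    (hA : AlgebraicIndependent R A) (k : ι) {P : F}
    (hP : P ∈ Algebra.adjoin R (A '' {k}ᶜ)) (hP0 : P ≠ 0) :
    AlgebraicIndependent R (Function.update A k (P / A k)) := by
  have huniv : (Set.univ : Set ι) = insert k {k}ᶜ := by ext; simp [em]
  have hcongr (B : ι → F) : AlgebraicIndependent R B ↔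
      AlgebraicIndepOn R B {k}ᶜ ∧ Transcendental (Algebra.adjoin R (B '' {k}ᶜ)) (B k) := by
    rw [← AlgebraicIndepOn.insert_iff (by simp), ← huniv, AlgebraicIndepOn]
    exact (algebraicIndependent_equiv (Equiv.Set.univ ι) (f := B)).symm
  rw [hcongr] at hA ⊢
  have hne {i : ι} (hi : i ∈ ({k}ᶜ : Set ι)) : Function.update A k (P / A k) i = A i :=
    Function.update_of_ne hi _ _
  have him : Function.update A k (P / A k) '' {k}ᶜ = A '' {k}ᶜ :=
    Set.image_congr fun i hi => hne hi
  rw [him, Function.update_self]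
  refine ⟨?_, fun halg => hA.2 ?_⟩
  · have : (fun i : ({k}ᶜ : Set ι) => Function.update A k (P / A k) i) = fun i : ({k}ᶜ : Set ι) => A i :=
      funext fun i => hne i.2
    rw [AlgebraicIndepOn, this]
    exact hA.1
  -- If `P / A k` were algebraic over the other members, so would be `A k = P * (P / A k)⁻¹`.
  · have hPalg : IsAlgebraic (Algebra.adjoin R (A '' {k}ᶜ)) P :=
      isAlgebraic_algebraMap (⟨P, hP⟩ : Algebra.adjoin R (A '' {k}ᶜ))
    have := hPalg.mul halg.inv
    rwa [inv_div, mul_div_cancel₀ _ hP0] at this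

end AlgebraicIndependence

namespace SeedData

/-! ### Columns of the extended exchange matrix. -/

section Columns

variable {m n : ℕ} {F : Type*} (S : SeedData (Trop m) F n)

/-- A column of the extended exchange matrix. -/
def extCol (k : Fin n) : Fin n ⊕ Fin m → ℤ := fun i => S.extendedMatrix i k

lemma extCol_inl (k i : Fin n) : S.extCol k (.inl i) = S.B i k := rfl

lemma extCol_inr (k : Fin n) (l : Fin m) : S.extCol k (.inr l) = Multiplicative.toAdd (S.X k) l :=
  rfl

/-- The columns of the extended exchange matrix are linearly independent. -/
def ColIndependent : Prop :=
  ∀ u : Fin n → ℤ, (∀ i, ∑ j, S.extCol j i * u j = 0) → u = 0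

lemma IsFullRank.colIndependent {S : SeedData (Trop m) F n} (h : S.IsFullRank) :
    S.ColIndependent := by
  intro u hu
  set E := S.extendedMatrix.map (Int.cast : ℤ → ℚ) with hE
  have h1 : Module.finrank ℚ (LinearMap.range E.mulVecLin) = n := h
  have h2 := LinearMap.finrank_range_add_finrank_ker E.mulVecLin
  rw [h1, Module.finrank_fin_fun] at h2
  have h3 : LinearMap.ker E.mulVecLin = ⊥ := Submodule.finrank_eq_zero.1 (by omega)
  have h4 : (fun j => (u j : ℚ)) ∈ LinearMap.ker E.mulVecLin := by
    rw [LinearMap.mem_ker, Matrix.mulVecLin_apply]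
    ext i
    have := hu i
    simp only [Matrix.mulVec, dotProduct, hE, Matrix.map_apply, Pi.zero_apply]
    exact_mod_cast this
  rw [h3, Submodule.mem_bot] at h4
  ext j
  have := congrFun h4 j
  simpa using this

lemma ColIndependent.extCol_ne_zero {S : SeedData (Trop m) F n} (h : S.ColIndependent)
    (k : Fin n) : S.extCol k ≠ 0 := by
  classical
  intro h0
  have := h (Pi.single k 1) fun i => by simp [Pi.single_apply, h0]
  simpa using congrFun this k

lemma ColIndependent.exists_minor_ne {S : SeedData (Trop m) F n} (h : S.ColIndependent)
    {p q : Fin n} (hpq : p ≠ q) :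
    ∃ i j, S.extCol p i * S.extCol q j ≠ S.extCol p j * S.extCol q i := by
  classical
  by_contra! hall
  obtain ⟨i, hi⟩ := Function.ne_iff.1 (h.extCol_ne_zero p)
  -- If all minors vanished, this would be a relation between the two columns, nontrivial because
  -- `S.extCol p i ≠ 0`.
  have := h (Pi.single q (S.extCol p i) - Pi.single p (S.extCol q i)) fun j => by
    simp only [Pi.sub_apply, mul_sub, Finset.sum_sub_distrib, Pi.single_apply, mul_ite, mul_zero,
      Finset.sum_ite_eq', Finset.mem_univ, if_true]
    linarith [hall i j]
  have h1 := congrFun this q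
  simp [hpq.symm] at h1
  exact hi h1

end Columns

/-! ### Coefficients as frozen variables; mutation of extended clusters and columns. -/

variable (K : Type*) [CommRing K] {m n : ℕ} {F : Type*} [Field F]
  [Algebra (MonoidAlgebra K (Trop m)) F]

/-- The variable `Z_l` of the tropical semifield. -/
def tropVar {m : ℕ} (l : Fin m) : Trop m := Multiplicative.ofAdd (Pi.single l (1 : ℤ))

/-- The members of the cluster together with the generators of the coefficient group. -/
def tuple (S : SeedData (Trop m) F n) : Fin n ⊕ Fin m → F :=
  Sum.elim S.A fun l => coeff K F (tropVar l)

variable (S : SeedData (Trop m) F n)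

lemma coeff_mul (x y : Trop m) : coeff K F (x * y) = coeff K F x * coeff K F y := by
  rw [coeff, map_mul, map_mul]; rfl

lemma coeff_one : coeff K F (1 : Trop m) = 1 := by
  rw [coeff, map_one, map_one]

/-- The embedding of the coefficient group as a homomorphism. -/
def coeffHom : Trop m →* F where
  toFun := coeff K F
  map_one' := coeff_one K
  map_mul' := coeff_mul K

lemma coeff_ne_zero (x : Trop m) : coeff K F x ≠ 0 := by
  intro h
  have := coeff_mul (F := F) K x x⁻¹
  rw [mul_inv_cancel, coeff_one, h, zero_mul] at this
  exact one_ne_zero this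

lemma coeff_eq_prod (x : Trop m) : coeff K F x =
    ∏ l, coeff K F (tropVar l) ^ Multiplicative.toAdd x l := by
  have hx : x = ∏ l, tropVar l ^
      Multiplicative.toAdd x l := by
    apply Multiplicative.toAdd.injective
    rw [toAdd_prod]
    simp only [toAdd_zpow]
    ext i
    simp [tropVar, Finset.sum_apply, Pi.single_apply]
  have h := congrArg (coeffHom (F := F) K) hx
  rw [map_prod] at h
  simp only [map_zpow] at h
  exact h

lemma mon_tuple (u : Fin n ⊕ Fin m → ℤ) : mon (S.tuple K) u =
    coeff K F (Multiplicative.ofAdd fun l => u (.inr l)) * ∏ i, S.A i ^ u (.inl i) := by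
  rw [mon, Fintype.prod_sum_type, mul_comm, coeff_eq_prod]
  rfl

/-- Dividing `X_k` and `1` by `1 ⊕ X_k` subtracts `min 0 x` from each exponent, leaving the positive
and negative parts of `x`. -/
lemma exchangeBinomial_eq (k : Fin n) :
    S.exchangeBinomial K k = exch (S.tuple K) (S.extCol k) := by
  rw [exchangeBinomial, exch, mon_tuple, mon_tuple]
  congr 2
  · congr 1
    apply Multiplicative.toAdd.injective
    ext l
    change Multiplicative.toAdd (S.X k) l - min 0 (Multiplicative.toAdd (S.X k) l)
      = max (Multiplicative.toAdd (S.X k) l) 0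
    omega
  · refine Finset.prod_congr rfl fun i _ => ?_
    rw [extCol_inl, ← Int.ofNat_toNat, zpow_natCast]
  · congr 1
    apply Multiplicative.toAdd.injective
    ext l
    change 0 - min 0 (Multiplicative.toAdd (S.X k) l)
      = max (-Multiplicative.toAdd (S.X k) l) 0
    omega
  · refine Finset.prod_congr rfl fun i _ => ?_
    rw [extCol_inl, ← Int.ofNat_toNat, zpow_natCast]

lemma tuple_mutate (k : Fin n) :
    (S.mutate K k).tuple K = mutTuple (S.tuple K) (S.extCol k) (.inl k) := by
  funext i
  rw [mutTuple, ← exchangeBinomial_eq]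
  rcases i with i | l
  · by_cases hi : i = k
    · subst hi
      simp [tuple, mutate, div_eq_inv_mul]
    · rw [Function.update_of_ne (by simpa using hi)]
      simp [tuple, mutate, hi]
  · rw [Function.update_of_ne (by simp)]
    simp [tuple]

lemma extCol_mutate_self (k : Fin n) : (S.mutate K k).extCol k = -S.extCol k := by
  ext (i | l)
  · exact mutateMatrix_right k i
  · simp [extCol_inr, mutate]

lemma extCol_mutate_inl (k j : Fin n) :
    (S.mutate K k).extCol j (.inl k) = -S.extCol j (.inl k) :=
  mutateMatrix_left k j

lemma extCol_mutate_of_ne {k j : Fin n} (hj : j ≠ k) (i : Fin n ⊕ Fin m) (hi : i ≠ .inl k) :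
    (S.mutate K k).extCol j i = S.extCol j i + max (S.extCol k i) 0 * S.extCol j (.inl k)
      + S.extCol k i * max (-S.extCol j (.inl k)) 0 := by
  rcases i with i | l
  · exact mutateMatrix_of_ne (fun h => hi (h ▸ rfl)) hj
  · have : (S.mutate K k).extCol j (.inr l) = Multiplicative.toAdd (S.X j) l
        + max (S.B k j) 0 * Multiplicative.toAdd (S.X k) l
        + -S.B k j * min 0 (Multiplicative.toAdd (S.X k) l) := by
      simp only [extCol_inr, mutate, if_neg hj, toAdd_mul, toAdd_zpow]
      rfl
    rw [this, add_assoc, max_mul_add_neg_mul_min, ← add_assoc]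
    rfl

/-- Row `k` is only negated, so a relation among the new columns satisfies it in the old matrix.
This kills the correction with `max (S.extCol k i) 0`; the other correction is a multiple of column
`k` and is absorbed into the coefficient of that column, giving the relation `u'` among the old
columns. -/
lemma ColIndependent.mutate {S : SeedData (Trop m) F n} (h : S.ColIndependent)
    (hB : IsSkewSymmetrizable S.B) (k : Fin n) : (S.mutate K k).ColIndependent := by
  classical
  intro u hu
  set u' : Fin n → ℤ :=
    Function.update u k (-u k + ∑ j ∈ Finset.univ.erase k, max (-S.extCol j (.inl k)) 0 * u j)
    with hu'
  have hsplit (f : Fin n → ℤ) : ∑ j, f j = f k + ∑ j ∈ Finset.univ.erase k, f j :=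
    (Finset.add_sum_erase _ f (Finset.mem_univ k)).symm
  have hkk : S.extCol k (.inl k) = 0 := hB.diag k
  have hrow : ∑ j ∈ Finset.univ.erase k, S.extCol j (.inl k) * u j = 0 := by
    have := hu (.inl k)
    simp only [extCol_mutate_inl, neg_mul, Finset.sum_neg_distrib, neg_eq_zero] at this
    rwa [hsplit, hkk, zero_mul, zero_add] at this
  have hsum (i) : ∑ j, S.extCol j i * u' j = S.extCol k i * u' k
      + ∑ j ∈ Finset.univ.erase k, S.extCol j i * u j := by
    rw [hsplit]
    congr 1
    refine Finset.sum_congr rfl fun j hj => ?_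
    rw [hu', Function.update_of_ne (Finset.ne_of_mem_erase hj)]
  have hu'0 : u' = 0 := by
    apply h
    intro i
    rw [hsum]
    by_cases hi : i = .inl k
    · rw [hi, hkk, hrow]; simp
    · have h1 := hu i
      rw [hsplit, extCol_mutate_self] at h1
      have h2 : ∑ j ∈ Finset.univ.erase k, (S.mutate K k).extCol j i * u j
          = ∑ j ∈ Finset.univ.erase k, S.extCol j i * u j
            + max (S.extCol k i) 0 * ∑ j ∈ Finset.univ.erase k, S.extCol j (.inl k) * u j
            + S.extCol k i *
              ∑ j ∈ Finset.univ.erase k, max (-S.extCol j (.inl k)) 0 * u j := by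
        rw [Finset.mul_sum, Finset.mul_sum, ← Finset.sum_add_distrib, ← Finset.sum_add_distrib]
        refine Finset.sum_congr rfl fun j hj => ?_
        rw [extCol_mutate_of_ne K S (Finset.ne_of_mem_erase hj) i hi]
        ring
      rw [h2, hrow, Pi.neg_apply] at h1
      rw [hu', Function.update_self]
      linarith
  have hj (j : Fin n) (hj : j ≠ k) : u j = 0 := by
    have := congrFun hu'0 j
    rwa [hu', Function.update_of_ne hj] at this
  ext j
  by_cases hjk : j = k
  · subst hjk
    have := congrFun hu'0 j
    rw [hu', Function.update_self, Finset.sum_eq_zero fun i hi => by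
      rw [hj i (Finset.ne_of_mem_erase hi), mul_zero]] at this
    simpa using this
  · exact hj j hjk

lemma coeff_mem_laurentRing (x : Trop m) : coeff K F x ∈ S.laurentRing K :=
  Subalgebra.algebraMap_mem (S.laurentRing K) (MonoidAlgebra.of K (Trop m) x)

variable [Algebra K F]

lemma coeff_mem (x : Trop m) : coeff K F x ∈ laurentSubalgebra K (S.tuple K) := by
  rw [coeff_eq_prod]
  exact prod_mem fun l _ => zpow_mem_of_inv_mem (gen_mem (S.tuple K) (.inr l))
    (gen_inv_mem (S.tuple K) (.inr l)) _

variable [IsScalarTower K (MonoidAlgebra K (Trop m)) F]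

lemma algebraMap_mem (r : MonoidAlgebra K (Trop m)) :
    algebraMap _ F r ∈ laurentSubalgebra K (S.tuple K) := by
  induction r using MonoidAlgebra.induction_on with
  | of x => exact coeff_mem K S x
  | add f g hf hg => rw [map_add]; exact add_mem hf hg
  | smul c f hf =>
    rw [Algebra.smul_def, map_mul, ← IsScalarTower.algebraMap_apply]
    exact mul_mem (Subalgebra.algebraMap_mem _ c) hf

/-- The group ring is itself a Laurent ring in the `Z_l`, so cluster and frozen variables can be
treated alike over `K`. -/
lemma mem_laurentRing {y : F} :
    y ∈ S.laurentRing K ↔ y ∈ laurentSubalgebra K (S.tuple K) := by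
  constructor
  · intro hy
    induction hy using Algebra.adjoin_induction with
    | mem x hx =>
      rcases hx with ⟨i, rfl⟩ | ⟨i, rfl⟩
      · exact gen_mem (S.tuple K) (.inl i)
      · exact gen_inv_mem (S.tuple K) (.inl i)
    | algebraMap r => exact algebraMap_mem K S r
    | add x y _ _ hx hy => exact add_mem hx hy
    | mul x y _ _ hx hy => exact mul_mem hx hy
  · intro hy
    have hgen : ∀ i, S.tuple K i ∈ S.laurentRing K ∧ (S.tuple K i)⁻¹ ∈ S.laurentRing K := by
      rintro (i | l)
      · exact ⟨Algebra.subset_adjoin (Or.inl ⟨i, rfl⟩), Algebra.subset_adjoin (Or.inr ⟨i, rfl⟩)⟩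
      · refine ⟨coeff_mem_laurentRing K S (tropVar l), ?_⟩
        have h : (coeff K F (tropVar l))⁻¹ = coeff K F (tropVar l)⁻¹ :=
          (map_inv (coeffHom (F := F) K) _).symm
        change (coeff K F (tropVar l))⁻¹ ∈ _
        rw [h]
        exact coeff_mem_laurentRing K S _
    have : laurentSubalgebra K (S.tuple K) ≤ (S.laurentRing K).restrictScalars K :=
      laurentSubalgebra_le (fun i => (Subalgebra.mem_restrictScalars K).2 (hgen i).1)
        fun i => (Subalgebra.mem_restrictScalars K).2 (hgen i).2
    exact (Subalgebra.mem_restrictScalars K).1 (this hy)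

lemma isFree_tuple [Nontrivial K] {S : SeedData (Trop m) F n}
    (hA : AlgebraicIndependent (MonoidAlgebra K (Trop m)) S.A) : IsFree K (S.tuple K) := by
  classical
  have hbasis : LinearIndependent K fun x : Trop m => MonoidAlgebra.of K (Trop m) x := by
    refine LinearIndependent.of_comp
      ({ toFun := MonoidAlgebra.coeff, map_add' := fun _ _ => rfl, map_smul' := fun _ _ => rfl } :
        MonoidAlgebra K (Trop m) →ₗ[K] (Trop m →₀ K)) ?_
    exact Finsupp.linearIndependent_single_one K (Trop m)
  have hmono : LinearIndependent (MonoidAlgebra K (Trop m))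
      fun s : Fin n →₀ ℕ => ∏ i, S.A i ^ s i := by
    have h1 := (MvPolynomial.basisMonomials (Fin n) (MonoidAlgebra K (Trop m))).linearIndependent
    have h2 := h1.map' (MvPolynomial.aeval S.A).toLinearMap (LinearMap.ker_eq_bot.2 hA)
    have h3 : (fun s : Fin n →₀ ℕ => ∏ i, S.A i ^ s i) = (MvPolynomial.aeval S.A).toLinearMap ∘
        MvPolynomial.basisMonomials (Fin n) (MonoidAlgebra K (Trop m)) := by
      funext s
      simp [MvPolynomial.aeval_monomial, Finsupp.prod_fintype]
    rw [h3]
    exact h2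
  have hprod := linearIndependent_smul hbasis hmono
  have hA0 (i) : S.A i ≠ 0 := hA.ne_zero i
  have hz : ∀ i, S.tuple K i ≠ 0 := by
    rintro (i | l)
    exacts [hA0 i, coeff_ne_zero K _]
  refine linearIndependent_iff_finset_linearIndependent.2 fun s => ?_
  -- Finitely many Laurent monomials become polynomial in the cluster after a common shift; these
  -- are products of the group ring basis and the independent cluster monomials.
  obtain ⟨N, hN⟩ : ∃ N : ℕ, ∀ u ∈ s, ∀ i : Fin n, 0 ≤ u (.inl i) + N := by
    refine ⟨s.sup fun u => Finset.univ.sup fun i : Fin n => (-u (.inl i)).toNat,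
      fun u hu i => ?_⟩
    have h1 := Finset.le_sup (f := fun i : Fin n => (-u (.inl i)).toNat) (Finset.mem_univ i)
    have h2 := Finset.le_sup
      (f := fun u : Fin n ⊕ Fin m → ℤ => Finset.univ.sup fun i : Fin n => (-u (.inl i)).toNat) hu
    have h3 := h1.trans h2
    omega
  set shift : Fin n ⊕ Fin m → ℤ := Sum.elim (fun _ => N) 0
  refine LinearIndependent.of_comp (LinearMap.mulLeft K (mon (S.tuple K) shift)) ?_
  let e : s → Trop m × (Fin n →₀ ℕ) := fun u =>
    (Multiplicative.ofAdd fun l => u.1 (.inr l),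
      Finsupp.equivFunOnFinite.symm fun i => (u.1 (.inl i) + N).toNat)
  have he : Function.Injective e := by
    intro u u' huu
    rw [Prod.ext_iff] at huu
    ext (i | l)
    · have h1 := DFunLike.congr_fun huu.2 i
      have h2 := hN u.1 u.2 i
      have h3 := hN u'.1 u'.2 i
      simp only [e, Finsupp.equivFunOnFinite_symm_apply_apply] at h1
      omega
    · exact congrFun (Multiplicative.ofAdd.injective huu.1) l
  have heq : LinearMap.mulLeft K (mon (S.tuple K) shift) ∘ (mon (S.tuple K) ∘ Subtype.val) =
      (fun p : Trop m × (Fin n →₀ ℕ) =>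
        MonoidAlgebra.of K (Trop m) p.1 • ∏ i, S.A i ^ p.2 i) ∘ e := by
    funext u
    simp only [Function.comp_apply, LinearMap.mulLeft_apply]
    rw [← mon_add hz, mon_tuple, Algebra.smul_def]
    congr 1
    · change coeff K F _ = coeff K F _
      congr 2
      funext l
      simp [shift]
    · refine Finset.prod_congr rfl fun i _ => ?_
      have := hN u.1 u.2 i
      rw [← zpow_natCast]
      congr 1
      simp only [e, shift, Pi.add_apply, Sum.elim_inl, Finsupp.equivFunOnFinite_symm_apply_apply]
      omega
  rw [heq]
  exact hprod.comp e he

/-! ### Reduction of the upper cluster algebra to the initial seed and its neighbours. -/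

/-- The properties of seeds in a seed pattern of full rank that are used below. -/
structure IsFullRankSeed (S : SeedData (Trop m) F n) : Prop where
  skew : IsSkewSymmetrizable S.B
  algebraicIndependent : AlgebraicIndependent (MonoidAlgebra K (Trop m)) S.A
  colIndependent : S.ColIndependent

variable {K} {S}

lemma IsFullRankSeed.isFree [Nontrivial K] (h : S.IsFullRankSeed K) : IsFree K (S.tuple K) :=
  isFree_tuple K h.algebraicIndependent

variable [IsDomain K] [CharZero K]

lemma IsFullRankSeed.exch_ne_zero (h : S.IsFullRankSeed K) (v : Fin n ⊕ Fin m → ℤ) :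
    exch (S.tuple K) v ≠ 0 := ClusterAlg.exch_ne_zero h.isFree v

lemma IsFullRankSeed.mutate (h : S.IsFullRankSeed K) (k : Fin n) :
    (S.mutate K k).IsFullRankSeed K where
  skew := h.skew.mutateMatrix k
  colIndependent := h.colIndependent.mutate K h.skew k
  algebraicIndependent := by
    have h1 : (S.mutate K k).A = Function.update S.A k (S.exchangeBinomial K k / S.A k) := by
      funext i
      by_cases hi : i = k
      · subst hi; simp [SeedData.mutate, div_eq_inv_mul]
      · simp [SeedData.mutate, hi]
    rw [h1]
    refine algebraicIndependent_update_div h.algebraicIndependent k ?_ ?_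
    · have hmem (f : Fin n → ℕ) (hf : f k = 0) :
          ∏ j, S.A j ^ f j ∈ Algebra.adjoin (MonoidAlgebra K (Trop m)) (S.A '' {k}ᶜ) := by
        refine prod_mem fun j _ => ?_
        by_cases hj : j = k
        · rw [hj, hf, pow_zero]; exact one_mem _
        · exact pow_mem (Algebra.subset_adjoin (Set.mem_image_of_mem S.A hj)) _
      have hkk := h.skew.diag k
      exact add_mem (mul_mem (Subalgebra.algebraMap_mem _ _) (hmem _ (by simp [hkk])))
        (mul_mem (Subalgebra.algebraMap_mem _ _) (hmem _ (by simp [hkk])))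
    · rw [exchangeBinomial_eq]
      exact h.exch_ne_zero _

lemma IsFullRankSeed.tuple_mutate_mutate (h : S.IsFullRankSeed K) (k : Fin n) :
    ((S.mutate K k).mutate K k).tuple K = S.tuple K := by
  rw [tuple_mutate, extCol_mutate_self, tuple_mutate, mutTuple, exch_neg]
  have h1 : exch (mutTuple (S.tuple K) (S.extCol k) (.inl k)) (S.extCol k)
      = exch (S.tuple K) (S.extCol k) := by
    refine exch_congr fun i hi => Function.update_of_ne (fun hik => hi ?_) _ _
    rw [hik]; exact h.skew.diag k
  have h2 := h.exch_ne_zero (S.extCol k)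
  have h3 := h.isFree.ne_zero (.inl k)
  rw [h1]
  simp only [mutTuple, Function.update_self, Function.update_idem, div_div_cancel₀ h2]
  exact Function.update_eq_self _ _

/-- An element of the Laurent polynomial rings of a seed and of all its neighbours lies in the
Laurent polynomial ring of every seed of the pattern. -/
theorem IsFullRankSeed.mem_laurentRing_seedAt (h : S.IsFullRankSeed K) {y : F}
    (hy : y ∈ S.laurentRing K) (hy' : ∀ k, y ∈ (S.mutate K k).laurentRing K)
    (w : List (Fin n)) : y ∈ (S.seedAt K w).laurentRing K := by
  induction w generalizing S with
  | nil => exact hy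
  | cons k w ih =>
    -- The base seed moves to the neighbour `k`. Its own neighbour in direction `k` has the initial
    -- extended cluster again; the other neighbours are ends of paths `t_j — t — t_k — t_{kj}`.
    refine ih (h.mutate k) (hy' k) fun j => ?_
    rw [mem_laurentRing]
    by_cases hj : j = k
    · subst hj
      rw [h.tuple_mutate_mutate, ← mem_laurentRing]
      exact hy
    · have hk := hy' k
      have hj' := hy' j
      have hfree := ((h.mutate k).mutate j).isFree
      rw [mem_laurentRing, tuple_mutate] at hk hj'
      rw [tuple_mutate, tuple_mutate] at hfree ⊢
      have hpq : (Sum.inl k : Fin n ⊕ Fin m) ≠ Sum.inl j := fun e => hj (Sum.inl_injective e).symm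
      have hkk : S.extCol k (Sum.inl k) = 0 := h.skew.diag k
      have hjj : S.extCol j (Sum.inl j) = 0 := h.skew.diag j
      have hzero : S.extCol k (Sum.inl j) = 0 ↔ S.extCol j (Sum.inl k) = 0 :=
        h.skew.eq_zero_iff j k
      have hsign : S.extCol k (Sum.inl j) * S.extCol j (Sum.inl k) ≤ 0 := h.skew.mul_nonpos j k
      exact mem_laurentSubalgebra_of_path hpq hkk hjj hzero hsign
        (extCol_mutate_inl K S k j) (extCol_mutate_of_ne K S hj)
        (h.colIndependent.exists_minor_ne (Ne.symm hj)) h.isFree.ne_zero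
        (h.exch_ne_zero _) hfree hk hj'

lemma IsFullRankSeed.mem_upperClusterAlgebra (h : S.IsFullRankSeed K) {y : F} :
    y ∈ S.upperClusterAlgebra K ↔
      y ∈ S.laurentRing K ∧ ∀ k, y ∈ (S.mutate K k).laurentRing K := by
  simp only [upperClusterAlgebra, Algebra.mem_iInf]
  exact ⟨fun hy => ⟨hy [], fun k => hy [k]⟩, fun hy => h.mem_laurentRing_seedAt hy.1 hy.2⟩

end SeedData

/-! ### Existence and uniqueness of the numerator polynomial and the `d`-vector. -/

section Numerators

open MvPolynomial

variable {R : Type*} [CommRing R] [IsDomain R] {n : ℕ}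

lemma exists_eq_prod_X_pow_mul (p : MvPolynomial (Fin n) R) (hp : p ≠ 0) :
    ∃ (e : Fin n → ℕ) (p' : MvPolynomial (Fin n) R), p = (∏ i, X i ^ e i) * p' ∧
      ∀ j, ¬ X j ∣ p' := by
  classical
  induction hN : p.totalDegree using Nat.strong_induction_on generalizing p with
  | _ N ih =>
  by_cases h : ∀ j, ¬ X j ∣ p
  · exact ⟨0, p, by simp, h⟩
  push Not at h
  obtain ⟨j, q, rfl⟩ := h
  have hq : q ≠ 0 := right_ne_zero_of_mul hp
  rw [totalDegree_mul_of_isDomain (X_ne_zero j) hq, totalDegree_X] at hN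
  obtain ⟨e, p', rfl, hp'⟩ := ih q.totalDegree (by omega) q hq rfl
  refine ⟨e + Pi.single j 1, p', ?_, hp'⟩
  have : ∏ i, (X i : MvPolynomial (Fin n) R) ^ (Pi.single j 1 : Fin n → ℕ) i = X j := by
    rw [Finset.prod_eq_single j]
    · simp
    · intro i _ hi; simp [hi]
    · simp
  simp only [Pi.add_apply, pow_add, Finset.prod_mul_distrib, this]
  ring

/-- Cancelling `X j ^ b j` would leave a factor `X j` on the left; this prime would have to divide
`p'` or another variable. -/
lemma exponent_le_of_mul_prod_X_pow_eq {p p' : MvPolynomial (Fin n) R} {a b : Fin n → ℕ}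
    (hp' : ∀ j, ¬ X j ∣ p') (h : p * ∏ i, X i ^ a i = p' * ∏ i, X i ^ b i) : a ≤ b := by
  classical
  intro j
  by_contra! hlt
  rw [← Finset.mul_prod_erase _ _ (Finset.mem_univ j),
    ← Finset.mul_prod_erase _ _ (Finset.mem_univ j)] at h
  obtain ⟨c, hc⟩ := Nat.exists_eq_add_of_lt hlt
  have h1 : X j ^ b j * (X j * (p * X j ^ c * ∏ i ∈ Finset.univ.erase j, X i ^ a i)) =
      X j ^ b j * (p' * ∏ i ∈ Finset.univ.erase j, X i ^ b i) := by
    rw [hc] at h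
    linear_combination h
  have h2 := mul_left_cancel₀ (pow_ne_zero _ (X_ne_zero j)) h1
  have hprime : Prime (X j : MvPolynomial (Fin n) R) := X_prime
  rcases hprime.dvd_or_dvd (Dvd.intro _ h2) with h3 | h3
  · exact hp' j h3
  · obtain ⟨i, hi, h4⟩ := hprime.exists_mem_finset_dvd h3
    have h5 := hprime.dvd_of_dvd_pow h4
    rw [X_dvd_X] at h5
    exact Finset.ne_of_mem_erase hi h5.symm

end Numerators

namespace SeedData

section ReducedForm

variable {K : Type*} [CommRing K] {P : Type*} [AuxSemifield P] {F : Type*} [Field F]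
  [Algebra (MonoidAlgebra K P) F] {n : ℕ} {S : SeedData P F n}

lemma isDomain_of_algebraicIndependent (hA : AlgebraicIndependent (MonoidAlgebra K P) S.A) :
    IsDomain (MonoidAlgebra K P) :=
  hA.algebraMap_injective.isDomain _

lemma exists_isReducedForm (hA : AlgebraicIndependent (MonoidAlgebra K P) S.A) {M : F}
    (hM : M ∈ S.laurentRing K) (hM0 : M ≠ 0) : ∃ d p, S.IsReducedForm K M d p := by
  classical
  have := isDomain_of_algebraicIndependent hA
  have hA0 (i) : S.A i ≠ 0 := hA.ne_zero i
  have hX (i) : S.A i ∈ (MvPolynomial.aeval (R := MonoidAlgebra K P) S.A).range :=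
    ⟨MvPolynomial.X i, MvPolynomial.aeval_X _ _⟩
  have hprod := prod_mem fun i (_ : i ∈ Finset.univ) => hX i
  have hM' : M ∈ localizedSubalgebra _ (∏ i, S.A i) hprod := by
    refine Algebra.adjoin_le ?_ hM
    rintro _ (⟨i, rfl⟩ | ⟨i, rfl⟩)
    · exact le_localizedSubalgebra _ _ _ (hX i)
    · refine ⟨1, ?_⟩
      rw [pow_one, ← Finset.mul_prod_erase _ _ (Finset.mem_univ i),
        inv_mul_cancel_left₀ (hA0 i)]
      exact prod_mem fun i _ => hX i
  obtain ⟨N, p, hp⟩ := hM'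
  change MvPolynomial.aeval S.A p = _ at hp
  have hp0 : p ≠ 0 := by
    rintro rfl
    rw [map_zero, eq_comm, mul_eq_zero] at hp
    exact hp.elim hM0 (pow_ne_zero _ (Finset.prod_ne_zero_iff.2 fun i _ => hA0 i))
  obtain ⟨e, p', rfl, hp'⟩ := exists_eq_prod_X_pow_mul p hp0
  -- `N` is the common power clearing the denominators and `e` the monomial factor of the resulting
  -- polynomial; the difference is taken in `ℤ`.
  refine ⟨fun i => N - e i, p', ?_, hp'⟩
  rw [map_mul, map_prod] at hp
  simp only [map_pow, MvPolynomial.aeval_X] at hp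
  have h1 (i) : S.A i ^ ((N : ℤ) - e i) = S.A i ^ N / S.A i ^ e i := by
    rw [zpow_sub₀ (hA0 i), zpow_natCast, zpow_natCast]
  simp only [h1, Finset.prod_div_distrib, Finset.prod_pow]
  have h2 : ∏ i, S.A i ^ e i ≠ 0 := Finset.prod_ne_zero_iff.2 fun i _ => pow_ne_zero _ (hA0 i)
  have h3 : ∏ i, S.A i ≠ 0 := Finset.prod_ne_zero_iff.2 fun i _ => hA0 i
  field_simp
  rw [← hp]; ring

lemma IsReducedForm.unique (hA : AlgebraicIndependent (MonoidAlgebra K P) S.A) {M : F}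
    {d d' : Fin n → ℤ} {p p' : MvPolynomial (Fin n) (MonoidAlgebra K P)}
    (h : S.IsReducedForm K M d p) (h' : S.IsReducedForm K M d' p') : d = d' ∧ p = p' := by
  have := isDomain_of_algebraicIndependent hA
  have hA0 (i) : S.A i ≠ 0 := hA.ne_zero i
  have hne (d : Fin n → ℤ) : ∏ i, S.A i ^ d i ≠ 0 :=
    Finset.prod_ne_zero_iff.2 fun i _ => zpow_ne_zero _ (hA0 i)
  -- Shifting both exponent vectors by `N` makes the cross-multiplied equation polynomial, so
  -- algebraic independence applies.
  obtain ⟨N, hN⟩ : ∃ N : ℕ, ∀ i, 0 ≤ d i + N ∧ 0 ≤ d' i + N := by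
    refine ⟨Finset.univ.sup fun i => (-d i).toNat + (-d' i).toNat, fun i => ?_⟩
    have := Finset.le_sup (f := fun i => (-d i).toNat + (-d' i).toNat) (Finset.mem_univ i)
    omega
  have hpow (d : Fin n → ℤ) (hd : ∀ i, 0 ≤ d i + N) : ∏ i, S.A i ^ (d i + N).toNat =
      (∏ i, S.A i ^ d i) * ∏ i, S.A i ^ N := by
    rw [← Finset.prod_mul_distrib]
    refine Finset.prod_congr rfl fun i _ => ?_
    rw [← zpow_natCast, Int.toNat_of_nonneg (hd i), zpow_add₀ (hA0 i), zpow_natCast]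
  have heq : p * ∏ i, MvPolynomial.X i ^ (d' i + N).toNat =
      p' * ∏ i, MvPolynomial.X i ^ (d i + N).toNat := by
    apply hA
    simp only [map_mul, map_prod, map_pow, MvPolynomial.aeval_X]
    rw [hpow d' fun i => (hN i).2, hpow d fun i => (hN i).1]
    have h1 := h.eq.symm.trans h'.eq
    rw [div_eq_div_iff (hne d) (hne d')] at h1
    linear_combination (∏ i, S.A i ^ N) * h1
  have h1 := exponent_le_of_mul_prod_X_pow_eq h'.not_dvd heq
  have h2 := exponent_le_of_mul_prod_X_pow_eq h.not_dvd heq.symm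
  have hd : d = d' := by
    ext i
    have h3 : (d' i + N).toNat ≤ (d i + N).toNat := h1 i
    have h4 : (d i + N).toNat ≤ (d' i + N).toNat := h2 i
    have := hN i
    omega
  subst hd
  refine ⟨rfl, ?_⟩
  exact mul_right_cancel₀
    (Finset.prod_ne_zero_iff.2 fun i _ => pow_ne_zero _ (MvPolynomial.X_ne_zero i)) heq

lemma IsReducedForm.dVector_eq (hA : AlgebraicIndependent (MonoidAlgebra K P) S.A) {M : F}
    {d : Fin n → ℤ} {p : MvPolynomial (Fin n) (MonoidAlgebra K P)}
    (h : S.IsReducedForm K M d p) : S.dVector K M = d := by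
  have hex : ∃ d p, S.IsReducedForm K M d p := ⟨d, p, h⟩
  rw [dVector, dif_pos hex]
  obtain ⟨p', hp'⟩ := hex.choose_spec
  exact (hp'.unique hA h).1

lemma A_mem_laurentRing_mutate_of_ne {k i : Fin n} (hi : i ≠ k) :
    S.A i ∈ (S.mutate K k).laurentRing K ∧ (S.A i)⁻¹ ∈ (S.mutate K k).laurentRing K := by
  have : S.A i = (S.mutate K k).A i := by simp [mutate, hi]
  rw [this]
  exact ⟨Algebra.subset_adjoin (Or.inl ⟨i, rfl⟩), Algebra.subset_adjoin (Or.inr ⟨i, rfl⟩)⟩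

lemma A_mem_laurentRing (i : Fin n) :
    S.A i ∈ S.laurentRing K ∧ (S.A i)⁻¹ ∈ S.laurentRing K :=
  ⟨Algebra.subset_adjoin (Or.inl ⟨i, rfl⟩), Algebra.subset_adjoin (Or.inr ⟨i, rfl⟩)⟩

end ReducedForm

end SeedData

/-! ### Valuations along cluster variables. -/

section Valuation

lemma valPairing_eq {R F : Type*} [CommRing R] [Field F] [Algebra R F] {U : Subalgebra R F}
    {a M : F} {b : ℕ} (hb : M / a ^ b ∈ U) (h : ∀ s : ℕ, M / a ^ s ∈ U → s ≤ b) :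
    valPairing U a M = b :=
  le_antisymm (iSup_le fun s => by exact_mod_cast h s.1 s.2)
    (le_iSup (fun s : {s : ℕ // M / a ^ s ∈ U} => ((s : ℕ) : ℕ∞)) ⟨b, hb⟩)

end Valuation

namespace SeedData

variable {K : Type*} [CommRing K] [IsDomain K] [CharZero K] {m n : ℕ} {F : Type*} [Field F]
  [Algebra (MonoidAlgebra K (Trop m)) F] [Algebra K F]
  [IsScalarTower K (MonoidAlgebra K (Trop m)) F] {S : SeedData (Trop m) F n}

namespace IsFullRankSeed

/-- The exchange relation, with the exchange binomial written in the mutated cluster. -/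
lemma A_eq (h : S.IsFullRankSeed K) (k : Fin n) :
    S.A k = exch ((S.mutate K k).tuple K) (S.extCol k) / (S.mutate K k).A k := by
  have h1 : exch ((S.mutate K k).tuple K) (S.extCol k) = exch (S.tuple K) (S.extCol k) := by
    rw [tuple_mutate]
    refine exch_congr fun i hi => Function.update_of_ne (fun hik => hi ?_) _ _
    rw [hik]; exact h.skew.diag k
  have h2 := h.exch_ne_zero (S.extCol k)
  have h3 : S.A k ≠ 0 := h.algebraicIndependent.ne_zero k
  have h4 : (S.mutate K k).A k = (S.A k)⁻¹ * exch (S.tuple K) (S.extCol k) := by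
    rw [← exchangeBinomial_eq]; simp [SeedData.mutate]
  rw [h1, h4]
  field_simp

lemma A_self_mem (h : S.IsFullRankSeed K) (k : Fin n) :
    S.A k ∈ (S.mutate K k).laurentRing K := by
  rw [h.A_eq k, div_eq_mul_inv, mem_laurentRing]
  exact mul_mem (exch_mem _ _) (gen_inv_mem ((S.mutate K k).tuple K) (.inl k))

lemma A_mem_upperClusterAlgebra (h : S.IsFullRankSeed K) (i : Fin n) :
    S.A i ∈ S.upperClusterAlgebra K := by
  rw [h.mem_upperClusterAlgebra]
  refine ⟨(A_mem_laurentRing i).1, fun k => ?_⟩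
  by_cases hi : i = k
  · exact hi ▸ h.A_self_mem i
  · exact (A_mem_laurentRing_mutate_of_ne hi).1

lemma aeval_mem_upperClusterAlgebra (h : S.IsFullRankSeed K)
    (p : MvPolynomial (Fin n) (MonoidAlgebra K (Trop m))) :
    MvPolynomial.aeval S.A p ∈ S.upperClusterAlgebra K := by
  have h1 : MvPolynomial.aeval S.A p ∈
      Algebra.adjoin (MonoidAlgebra K (Trop m)) (Set.range S.A) := by
    rw [Algebra.adjoin_range_eq_range_aeval]
    exact ⟨p, rfl⟩
  refine Algebra.adjoin_le ?_ h1
  rintro _ ⟨i, rfl⟩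
  exact h.A_mem_upperClusterAlgebra i

/-- In the neighbouring Laurent ring `S.A k` is an exchange binomial times a unit, and full rank
makes its exponent vector nonzero. -/
lemma exists_div_pow_notMem (h : S.IsFullRankSeed K) (k : Fin n) {M : F} (hM0 : M ≠ 0) :
    ∃ s : ℕ, M / S.A k ^ s ∉ (S.mutate K k).laurentRing K := by
  have h' := h.mutate k
  obtain ⟨s, hs⟩ := exists_div_exch_pow_notMem h'.isFree (h.colIndependent.extCol_ne_zero k)
    (h'.exch_ne_zero _) hM0
  refine ⟨s, fun hmem => hs ?_⟩
  rw [mem_laurentRing, h.A_eq k] at hmem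
  have h1 : (S.mutate K k).A k ≠ 0 := h'.algebraicIndependent.ne_zero k
  have h2 := h'.exch_ne_zero (S.extCol k)
  have h3 : M / exch ((S.mutate K k).tuple K) (S.extCol k) ^ s =
      M / (exch ((S.mutate K k).tuple K) (S.extCol k) / (S.mutate K k).A k) ^ s *
        ((S.mutate K k).A k)⁻¹ ^ s := by
    rw [div_pow, inv_pow]
    field_simp
  rw [h3]
  exact mul_mem hmem (pow_mem (gen_inv_mem ((S.mutate K k).tuple K) (.inl k)) s)

/-- The order of a nonzero element of the upper cluster algebra along a cluster variable `A k`,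
measured in the Laurent polynomial ring of the neighbour in direction `k`. -/
lemma exists_order (h : S.IsFullRankSeed K) (k : Fin n) {M : F}
    (hM : M ∈ S.upperClusterAlgebra K) (hM0 : M ≠ 0) :
    ∃ b : ℕ, ∀ s : ℤ, M / S.A k ^ s ∈ (S.mutate K k).laurentRing K ↔ s ≤ b := by
  classical
  have hA0 : S.A k ≠ 0 := h.algebraicIndependent.ne_zero k
  have hmono {s t : ℤ} (hst : s ≤ t) (ht : M / S.A k ^ t ∈ (S.mutate K k).laurentRing K) :
      M / S.A k ^ s ∈ (S.mutate K k).laurentRing K := by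
    obtain ⟨c, rfl⟩ := Int.le.dest hst
    have : M / S.A k ^ s = M / S.A k ^ (s + c) * S.A k ^ c := by
      rw [zpow_add₀ hA0, zpow_natCast]
      have := zpow_ne_zero s hA0
      field_simp
    rw [this]
    exact mul_mem ht (pow_mem (h.A_self_mem k) c)
  have hex := h.exists_div_pow_notMem k hM0
  have hspec := Nat.find_spec hex
  have hmin := fun s => Nat.find_min (m := s) hex
  have hpos : Nat.find hex ≠ 0 := by
    intro h0
    rw [h0, pow_zero, div_one] at hspec
    exact hspec ((h.mem_upperClusterAlgebra.1 hM).2 k)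
  -- The first failing exponent is positive because `M` itself lies in the neighbouring ring; the
  -- order is its predecessor.
  obtain ⟨b, hb⟩ := Nat.exists_eq_succ_of_ne_zero hpos
  rw [hb] at hspec hmin
  refine ⟨b, fun s => ⟨fun hs => ?_, fun hs => ?_⟩⟩
  · by_contra! hlt
    apply hspec
    rw [← zpow_natCast]
    exact hmono (by push_cast; omega) hs
  · refine hmono hs ?_
    rw [zpow_natCast]
    exact not_not.1 (hmin b (Nat.lt_succ_self b))

/-- `S.A k` is a unit in the Laurent rings of `S` and of all neighbours in directions `j ≠ k`, so
only direction `k` can obstruct the division. -/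
lemma div_pow_mem_iff (h : S.IsFullRankSeed K) (k : Fin n) {M : F}
    (hM : M ∈ S.upperClusterAlgebra K) (s : ℕ) :
    M / S.A k ^ s ∈ S.upperClusterAlgebra K ↔ M / S.A k ^ s ∈ (S.mutate K k).laurentRing K := by
  rw [h.mem_upperClusterAlgebra] at hM ⊢
  refine ⟨fun hs => hs.2 k, fun hs => ⟨?_, fun j => ?_⟩⟩
  · rw [div_eq_mul_inv, ← inv_pow]
    exact mul_mem hM.1 (pow_mem (A_mem_laurentRing k).2 s)
  · by_cases hj : j = k
    · exact hj ▸ hs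
    · rw [div_eq_mul_inv, ← inv_pow]
      exact mul_mem (hM.2 j) (pow_mem (A_mem_laurentRing_mutate_of_ne (Ne.symm hj)).2 s)

lemma valPairing_eq_of_order (h : S.IsFullRankSeed K) (k : Fin n) {M : F}
    (hM : M ∈ S.upperClusterAlgebra K) {b : ℕ}
    (hb : ∀ s : ℤ, M / S.A k ^ s ∈ (S.mutate K k).laurentRing K ↔ s ≤ b) :
    valPairing (S.upperClusterAlgebra K) (S.A k) M = b := by
  have key (s : ℕ) : M / S.A k ^ s ∈ S.upperClusterAlgebra K ↔ s ≤ b := by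
    rw [h.div_pow_mem_iff k hM, ← zpow_natCast, hb, Nat.cast_le]
  exact valPairing_eq ((key b).2 le_rfl) fun s hs => (key s).1 hs

/-- The valuations of an element of the upper cluster algebra and of its numerator along a cluster
variable are finite, and differ by the corresponding component of the `d`-vector. -/
theorem exists_valPairing_eq (h : S.IsFullRankSeed K) (k : Fin n) {M : F}
    (hM : M ∈ S.upperClusterAlgebra K) (hM0 : M ≠ 0) {d : Fin n → ℤ}
    {p : MvPolynomial (Fin n) (MonoidAlgebra K (Trop m))} (hred : S.IsReducedForm K M d p) :
    ∃ a b : ℕ, valPairing (S.upperClusterAlgebra K) (S.A k) (MvPolynomial.aeval S.A p) = a ∧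
      valPairing (S.upperClusterAlgebra K) (S.A k) M = b ∧ d k = (a : ℤ) - b ∧
      (M / S.A k ∈ S.upperClusterAlgebra K ↔ b ≠ 0) := by
  have hA0 (i) : S.A i ≠ 0 := h.algebraicIndependent.ne_zero i
  obtain ⟨b, hb⟩ := h.exists_order k hM hM0
  set L := (S.mutate K k).laurentRing K
  have hp := h.aeval_mem_upperClusterAlgebra p
  set u := ∏ i ∈ Finset.univ.erase k, S.A i ^ d i with hu
  have hu0 : u ≠ 0 := Finset.prod_ne_zero_iff.2 fun i _ => zpow_ne_zero _ (hA0 i)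
  have humem : u ∈ L := prod_mem fun i hi =>
    zpow_mem_of_inv_mem (A_mem_laurentRing_mutate_of_ne (Finset.ne_of_mem_erase hi)).1
      (A_mem_laurentRing_mutate_of_ne (Finset.ne_of_mem_erase hi)).2 _
  have huinv : u⁻¹ ∈ L := by
    rw [hu, ← Finset.prod_inv_distrib]
    refine prod_mem fun i hi => ?_
    rw [← zpow_neg]
    exact zpow_mem_of_inv_mem (A_mem_laurentRing_mutate_of_ne (Finset.ne_of_mem_erase hi)).1
      (A_mem_laurentRing_mutate_of_ne (Finset.ne_of_mem_erase hi)).2 _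
  -- The numerator is `M * S.A k ^ d k` times the unit `u` of `L`. Orders are tested on integer
  -- exponents because `s - d k` may be negative.
  have hnum (s : ℤ) : MvPolynomial.aeval S.A p / S.A k ^ s ∈ L ↔ s ≤ b + d k := by
    have h1 : MvPolynomial.aeval S.A p / S.A k ^ s = M / S.A k ^ (s - d k) * u := by
      rw [hred.eq, ← Finset.mul_prod_erase _ _ (Finset.mem_univ k), ← hu, zpow_sub₀ (hA0 k)]
      have := zpow_ne_zero s (hA0 k)
      have := zpow_ne_zero (d k) (hA0 k)
      field_simp
    have h2 : M / S.A k ^ (s - d k) * u ∈ L ↔ M / S.A k ^ (s - d k) ∈ L :=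
      ⟨fun hs => by simpa [mul_assoc, hu0] using mul_mem hs huinv, fun hs => mul_mem hs humem⟩
    rw [h1, h2, hb]
    omega
  -- The numerator lies in `L`, so `s = 0` is admissible and its order `b + d k` is a natural
  -- number.
  have hnonneg : 0 ≤ (b : ℤ) + d k := by
    rw [← hnum, zpow_zero, div_one]
    exact (h.mem_upperClusterAlgebra.1 hp).2 k
  obtain ⟨a, ha⟩ := Int.eq_ofNat_of_zero_le hnonneg
  refine ⟨a, b, h.valPairing_eq_of_order k hp fun s => by rw [hnum, ha],
    h.valPairing_eq_of_order k hM hb, by omega, ?_⟩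
  have h1 := h.div_pow_mem_iff k hM 1
  rw [pow_one] at h1
  have h2 := hb 1
  rw [zpow_one] at h2
  rw [h1, h2]
  omega

end IsFullRankSeed

end SeedData

end ClusterAlg

end

theorem theorem5p1 {K : Type*} [CommRing K] [IsDomain K] [CharZero K]
    (hK : IsField K ∨ Nonempty (K ≃+* ℤ))
    {m n : ℕ} {F : Type*} [Field F] [Algebra (MonoidAlgebra K (ClusterAlg.Trop m)) F]
    (S : ClusterAlg.SeedData (ClusterAlg.Trop m) F n)
    (hS : S.IsSeed K) (hrank : S.IsFullRank)
    (U : Subalgebra (MonoidAlgebra K (ClusterAlg.Trop m)) F)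
    (hU : U = S.upperClusterAlgebra K) :
    -- the d-vector and the numerator polynomial of a nonzero element are well defined
    (∀ M ∈ U, M ≠ 0 →
      ∃! x : (Fin n → ℤ) × MvPolynomial (Fin n) (MonoidAlgebra K (ClusterAlg.Trop m)),
        S.IsReducedForm K M x.1 x.2) ∧
    (∀ M ∈ U, M ≠ 0 → ∀ (d : Fin n → ℤ)
      (p : MvPolynomial (Fin n) (MonoidAlgebra K (ClusterAlg.Trop m))),
      S.IsReducedForm K M d p →
        -- the numerator lies in the upper cluster algebra
        MvPolynomial.aeval S.A p ∈ U ∧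
        -- (i), where both valuations are finite
        (∀ k, d k = S.dCompat K k M ∧
          ∃ a b : ℕ,
            ClusterAlg.valPairing U (S.A k) (MvPolynomial.aeval S.A p) = a ∧
            ClusterAlg.valPairing U (S.A k) M = b ∧
            d k = (a : ℤ) - (b : ℤ)) ∧
        -- (ii)
        (∀ k,
          (ClusterAlg.valPairing U (S.A k) M = 0 ↔ M / S.A k ∉ U) ∧
          (ClusterAlg.valPairing U (S.A k) M = 0 →
            d k = S.dCompat K k M ∧ 0 ≤ d k ∧
            ∃ a : ℕ,
              ClusterAlg.valPairing U (S.A k) (MvPolynomial.aeval S.A p) = a ∧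
              d k = (a : ℤ)))) ∧
    -- (iii)
    (∀ M ∈ U, ∀ M' ∈ U, M ≠ 0 → M' ≠ 0 →
      (∀ k, ClusterAlg.valPairing U (S.A k) M = 0) →
      (∀ k, ClusterAlg.valPairing U (S.A k) M' = 0) →
      ∀ (d d' : Fin n → ℤ)
        (p : MvPolynomial (Fin n) (MonoidAlgebra K (ClusterAlg.Trop m))),
        S.IsReducedForm K M d p → S.IsReducedForm K M' d' p → d = d') := by
  -- The extended clusters generate Laurent rings over `K`, so `F` is made a `K`-algebra through the
  -- group ring.
  let _ : Algebra K F :=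
    Algebra.compHom F (algebraMap K (MonoidAlgebra K (ClusterAlg.Trop m)))
  have _ : IsScalarTower K (MonoidAlgebra K (ClusterAlg.Trop m)) F :=
    IsScalarTower.of_algebraMap_eq fun _ => rfl
  have h : S.IsFullRankSeed K :=
    ⟨hS.skew, hS.algebraicIndependent, ClusterAlg.SeedData.IsFullRank.colIndependent hrank⟩
  have hA := hS.algebraicIndependent
  subst hU
  refine ⟨fun M hM hM0 => ?_, fun M hM hM0 d p hred => ?_,
    fun M hM M' hM' hM0 hM0' hv hv' d d' p hred hred' => ?_⟩
  · obtain ⟨d, p, hred⟩ :=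
      ClusterAlg.SeedData.exists_isReducedForm hA (h.mem_upperClusterAlgebra.1 hM).1 hM0
    refine ⟨(d, p), hred, fun x hx => ?_⟩
    obtain ⟨h1, h2⟩ := hx.unique hA hred
    exact Prod.ext h1 h2
  · have hd (k) : d k = S.dCompat K k M := (congrFun (hred.dVector_eq hA) k).symm
    refine ⟨h.aeval_mem_upperClusterAlgebra p, fun k => ⟨hd k, ?_⟩, fun k => ?_⟩
    · obtain ⟨a, b, ha, hb, hdk, -⟩ := h.exists_valPairing_eq k hM hM0 hred
      exact ⟨a, b, ha, hb, hdk⟩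
    · obtain ⟨a, b, ha, hb, hdk, hdiv⟩ := h.exists_valPairing_eq k hM hM0 hred
      rw [hb, hdiv, Nat.cast_eq_zero, not_not]
      refine ⟨Iff.rfl, fun hb0 => ⟨hd k, ?_, a, ha, ?_⟩⟩
      · omega
      · omega
  · ext k
    obtain ⟨a, b, ha, hb, hdk, -⟩ := h.exists_valPairing_eq k hM hM0 hred
    obtain ⟨a', b', ha', hb', hdk', -⟩ := h.exists_valPairing_eq k hM' hM0' hred'
    rw [hv k, eq_comm, Nat.cast_eq_zero] at hb
    rw [hv' k, eq_comm, Nat.cast_eq_zero] at hb'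
    rw [ha, Nat.cast_inj] at ha'
    omega
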